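/- Let $\alpha>0$. Consider the white noise model $dY(t)=f(t)\,dt+n^{-1/2}\,dW(t)$ on $[0,1]$ in its equivalent sequence form: the data are $D_n=(Y_1,Y_2,\dots)$ with $Y_i=\theta_i+n^{-1/2}\varepsilon_i$, $\varepsilon_i$ i.i.d. $N(0,1)$, where $f=\sum_{i\ge1}\theta_i\phi_i$ in $L^2[0,1]$ and $\phi_1=1$, $\phi_{2m}(x)=\sqrt2\cos(2\pi mx)$, $\phi_{2m+1}(x)=\sqrt2\sin(2\pi mx)$ for $m\ge1$. Let $P_{f_0}$ and $\mathrm E_{f_0}$ refer to the law of the data when $f=f_0$. Let the prior $\Pi_\alpha$ on $f$ be given by independent $\theta_i\sim N(0,i^{-(2\alpha+1)})$, let $\Pi_\alpha(\cdot\mid D_n)$ be the posterior, and let $\hat f=\sum_i\hat\theta_i\phi_i$ with $\hat\theta_i=\mathrm E(\theta_i\mid D_n)$ be the posterior mean. For $R>0$ put $B(\alpha,R)=\{f=\sum_i\theta_i\phi_i:\ \sum_{i\ge1} i^\alpha|\theta_i|\le R\}$, let $\|\cdot\|_\infty$ be the $L_\infty$-norm on $[0,1]$, and let $\epsilon_n=n^{-\alpha/(2\alpha+1)}\sqrt{\log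 n}$. (a) For every $R>0$ and every sequence $M_n\to\infty$, $$\sup_{f_0\in B(\alpha,R)}\mathrm E_{f_0}\,\Pi_\alpha\bigl(f:\|f-f_0\|_\infty>M_n\epsilon_n\mid D_n\bigr)\to0 .$$ (b) Let $0<\gamma<1$. For every $n\ge1$ there is a deterministic $h_n>0$, depending only on $\alpha,\gamma,n$, such that for every $f_0\in\bigcup_{R>0}B(\alpha,R)$, $P_{f_0}$-almost surely, $h_n$ is the unique real number $r$ with $\Pi_\alpha(f:\|f-\hat f\|_\infty\le r\mid D_n)=1-\gamma$. There is a constant $C$, depending only on $\alpha,\gamma$, with $h_n\le C\epsilon_n$ for all $n\ge2$. There is a constant $M_0>0$, depending only on $\alpha,\gamma$, such that for all $M\ge M_0$ and $R>0$, $$\inf_{f_0\in B(\alpha,R)}P_{f_0}\bigl\{\|f_0-\hat f\|_\infty\le Mh_n\bigr\}\to1 .$$ -/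

import Mathlib

open MeasureTheory ProbabilityTheory Filter Topology
open scoped ENNReal NNReal

noncomputable section

namespace WhiteNoise

/-! Sequences indexed by `i = 1, 2, …` are written as functions on `ℕ`: the entry `k : ℕ` is the
one with the index `i = k + 1`. -/

/-- The Fourier basis of `[0, 1]`: `φ₁ = 1`, `φ_{2m}(x) = √2 cos (2π m x)`,
`φ_{2m+1}(x) = √2 sin (2π m x)` for `m ≥ 1`; here `fourierFun k = φ_{k+1}`. -/
def fourierFun (k : ℕ) (x : ℝ) : ℝ :=
  if k = 0 then 1
  else if Odd k then √2 * Real.cos (2 * Real.pi * ((k + 1) / 2 : ℕ) * x)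
  else √2 * Real.sin (2 * Real.pi * (k / 2 : ℕ) * x)

/-- Lebesgue measure on `[0, 1]`. -/
abbrev unitMeasure : Measure ℝ := volume.restrict (Set.Icc (0 : ℝ) 1)

theorem memLp_fourierFun (k : ℕ) : MemLp (fourierFun k) 2 unitMeasure := by
  have hc : Continuous (fourierFun k) := by
    unfold fourierFun
    split_ifs <;> fun_prop
  refine MemLp.of_bound hc.aestronglyMeasurable (√2) (ae_of_all _ fun x => ?_)
  have h1 : (1 : ℝ) ≤ √2 := Real.one_le_sqrt.2 (by norm_num)
  unfold fourierFun
  split_ifs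
  · simp
  · rw [norm_mul, Real.norm_of_nonneg (Real.sqrt_nonneg _)]
    exact mul_le_of_le_one_right (Real.sqrt_nonneg _) (Real.abs_cos_le_one _)
  · rw [norm_mul, Real.norm_of_nonneg (Real.sqrt_nonneg _)]
    exact mul_le_of_le_one_right (Real.sqrt_nonneg _) (Real.abs_sin_le_one _)

/-- The function `f = ∑ θ_i φ_i` with the Fourier coefficients `θ`, as a series in `L²[0, 1]`
(it converges for every square summable `θ`). -/
def fourierSum (θ : ℕ → ℝ) : Lp ℝ 2 unitMeasure :=
  ∑' k, θ k • (memLp_fourierFun k).toLp (fourierFun k)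

/-- The distance `‖f - g‖_∞` on `[0, 1]`, equal to `∞` if `f - g` is not essentially bounded. -/
def supDist (f g : Lp ℝ 2 unitMeasure) : ℝ≥0∞ :=
  eLpNorm (f - g : Lp ℝ 2 unitMeasure) ∞ unitMeasure

/-- The law of the noise: `ε_1, ε_2, …` i.i.d. standard normal. -/
def noise : Measure (ℕ → ℝ) := Measure.infinitePi fun _ => gaussianReal 0 1

instance : IsProbabilityMeasure noise := by unfold noise; infer_instance

/-- The Gaussian sequence model: `dataLaw n θ` is the law of `Y_i = θ_i + n^{-1/2} ε_i`. -/
def dataLaw (n : ℕ) : Kernel (ℕ → ℝ) (ℕ → ℝ) where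
  toFun θ := noise.map fun ε k => θ k + (√(n : ℝ))⁻¹ * ε k
  measurable' := by
    refine Measure.measurable_of_measurable_coe _ fun s hs => ?_
    have hm : Measurable fun p : (ℕ → ℝ) × (ℕ → ℝ) =>
        fun k => p.1 k + (√(n : ℝ))⁻¹ * p.2 k := by fun_prop
    have key := measurable_measure_prodMk_left (ν := noise) (hm hs)
    convert key using 2 with θ
    rw [Measure.map_apply (by fun_prop) hs]
    rfl

instance (n : ℕ) : IsMarkovKernel (dataLaw n) :=
  ⟨fun θ => by
    have hm : Measurable fun (ε : ℕ → ℝ) (k : ℕ) => θ k + (√(n : ℝ))⁻¹ * ε k := by fun_prop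
    exact Measure.isProbabilityMeasure_map (μ := noise) hm.aemeasurable⟩

/-- The prior: independent `θ_i ~ N(0, i^{-(2α+1)})`. -/
def prior (α : ℝ) : Measure (ℕ → ℝ) :=
  Measure.infinitePi fun k => gaussianReal 0 (((k : ℝ≥0) + 1) ^ (-(2 * α + 1)))

instance (α : ℝ) : IsProbabilityMeasure (prior α) := by unfold prior; infer_instance

/-- The posterior: the conditional law of `θ` given the data `Y`, when `θ` has the law `prior α`
and `Y` given `θ` has the law `dataLaw n θ`. -/
def post (α : ℝ) (n : ℕ) : Kernel (ℕ → ℝ) (ℕ → ℝ) := posterior (dataLaw n) (prior α)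

/-- The posterior mean `f̂ = ∑ θ̂_i φ_i`, `θ̂_i = E(θ_i | Y)`. -/
def postMean (α : ℝ) (n : ℕ) (y : ℕ → ℝ) : Lp ℝ 2 unitMeasure :=
  fourierSum fun k => ∫ θ, θ k ∂(post α n y)

/-- The class `B(α, R)` of the coefficient sequences with `∑ i^α |θ_i| ≤ R`. -/
def holderBall (α R : ℝ) : Set (ℕ → ℝ) :=
  {θ | Summable (fun k : ℕ => ((k : ℝ) + 1) ^ α * |θ k|) ∧
    ∑' k : ℕ, ((k : ℝ) + 1) ^ α * |θ k| ≤ R}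

/-- The rate `ε_n = n^{-α/(2α+1)} √(log n)`. -/
def rate (α : ℝ) (n : ℕ) : ℝ := (n : ℝ) ^ (-α / (2 * α + 1)) * √(Real.log n)

end WhiteNoise

end

noncomputable section

namespace WhiteNoise

/-! ### The Fourier basis -/

/-- The amplitude of `fourierFun k`. -/
def amplitude (k : ℕ) : ℝ := if k = 0 then 1 else √2

/-- The phase of `fourierFun k`. -/
def phase (k : ℕ) : ℝ := if k = 0 ∨ Odd k then 0 else Real.pi / 2

theorem fourierFun_eq_cos (k : ℕ) (x : ℝ) :
    fourierFun k x =
      amplitude k * Real.cos (2 * Real.pi * ((k + 1) / 2 : ℕ) * x - phase k) := by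
  unfold fourierFun amplitude phase
  by_cases h0 : k = 0
  · simp [h0]
  · by_cases h1 : Odd k
    · simp [h0, h1]
    · have h2 : (k + 1) / 2 = k / 2 := by
        rcases Nat.not_odd_iff_even.1 h1 with ⟨m, rfl⟩
        omega
      simp [h0, h1, h2, Real.cos_sub_pi_div_two]

theorem amplitude_nonneg (k : ℕ) : 0 ≤ amplitude k := by
  unfold amplitude; split_ifs <;> positivity

theorem amplitude_le (k : ℕ) : amplitude k ≤ √2 := by
  unfold amplitude; split_ifs
  · exact Real.one_le_sqrt.2 (by norm_num)
  · exact le_rfl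

theorem abs_fourierFun_le (k : ℕ) (x : ℝ) : |fourierFun k x| ≤ √2 := by
  rw [fourierFun_eq_cos, abs_mul, abs_of_nonneg (amplitude_nonneg k)]
  exact (mul_le_of_le_one_right (amplitude_nonneg k) (Real.abs_cos_le_one _)).trans (amplitude_le k)

theorem abs_fourierFun_sub_le (k : ℕ) (x y : ℝ) :
    |fourierFun k x - fourierFun k y| ≤ √2 * (2 * Real.pi * (k + 1)) * |x - y| := by
  have hcos : ∀ a b : ℝ, |Real.cos a - Real.cos b| ≤ |a - b| := fun a b => by
    have h := Real.lipschitzWith_cos.dist_le_mul a b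
    simpa [Real.dist_eq] using h
  rw [fourierFun_eq_cos, fourierFun_eq_cos, ← mul_sub, abs_mul, abs_of_nonneg (amplitude_nonneg k),
    mul_assoc (√2)]
  refine mul_le_mul (amplitude_le k) ((hcos _ _).trans ?_) (abs_nonneg _) (Real.sqrt_nonneg _)
  rw [sub_sub_sub_cancel_right, ← mul_sub, abs_mul, abs_of_nonneg (by positivity)]
  have : (((k + 1) / 2 : ℕ) : ℝ) ≤ k + 1 := by
    exact_mod_cast Nat.div_le_self _ _
  gcongr

theorem continuous_fourierFun (k : ℕ) : Continuous (fourierFun k) := by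
  have : fourierFun k = fun x => amplitude k *
      Real.cos (2 * Real.pi * ((k + 1) / 2 : ℕ) * x - phase k) := funext (fourierFun_eq_cos k)
  rw [this]; fun_prop

theorem integral_cos_two_pi_mul (j : ℤ) (b : ℝ) :
    ∫ x in (0 : ℝ)..1, Real.cos (2 * Real.pi * j * x - b) = if j = 0 then Real.cos b else 0 := by
  split_ifs with hj
  · simp [hj]
  · have hc : (2 * Real.pi * j : ℝ) ≠ 0 := by
      positivity
    rw [intervalIntegral.integral_comp_mul_sub (fun y => Real.cos y) hc b, integral_cos]
    have : Real.sin (2 * Real.pi * j * 1 - b) = Real.sin (2 * Real.pi * j * 0 - b) := by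
      rw [show 2 * Real.pi * j * 1 - b = (2 * Real.pi * j * 0 - b) + j * (2 * Real.pi) by ring,
        Real.sin_add_int_mul_two_pi]
    rw [this, sub_self, smul_zero]

theorem integral_fourierFun_mul (i k : ℕ) :
    ∫ x, fourierFun i x * fourierFun k x ∂unitMeasure = if i = k then 1 else 0 := by
  rw [integral_Icc_eq_integral_Ioc, ← intervalIntegral.integral_of_le zero_le_one]
  set m : ℕ := (i + 1) / 2 with hm
  set l : ℕ := (k + 1) / 2 with hl
  have hpt : ∀ x, fourierFun i x * fourierFun k x = amplitude i * amplitude k / 2 *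
      (Real.cos (2 * Real.pi * ((m : ℤ) - (l : ℤ) : ℤ) * x - (phase i - phase k)) +
        Real.cos (2 * Real.pi * ((m : ℤ) + (l : ℤ) : ℤ) * x - (phase i + phase k))) := fun x => by
    rw [fourierFun_eq_cos, fourierFun_eq_cos, ← hm, ← hl]
    push_cast
    rw [show 2 * Real.pi * ((m : ℝ) - l) * x - (phase i - phase k) =
        (2 * Real.pi * m * x - phase i) - (2 * Real.pi * l * x - phase k) by ring,
      show 2 * Real.pi * ((m : ℝ) + l) * x - (phase i + phase k) =
        (2 * Real.pi * m * x - phase i) + (2 * Real.pi * l * x - phase k) by ring,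
      Real.cos_add, Real.cos_sub (2 * Real.pi * m * x - phase i)]
    ring
  simp_rw [hpt]
  rw [intervalIntegral.integral_const_mul, intervalIntegral.integral_add
    (Continuous.intervalIntegrable (by fun_prop) _ _)
    (Continuous.intervalIntegrable (by fun_prop) _ _),
    integral_cos_two_pi_mul, integral_cos_two_pi_mul]
  have h2 : √2 * √2 = (2 : ℝ) := Real.mul_self_sqrt (by norm_num)
  by_cases hik : i = k
  · subst hik
    by_cases h0 : i = 0
    · norm_num [h0, hm, hl, amplitude, phase]
    · have h3 : ¬ ((m : ℤ) + l = 0) := by omega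
      have h4 : (m : ℤ) - l = 0 := by omega
      rw [if_neg h3, if_pos h4]
      simp [amplitude, h0, h2]
  · rw [if_neg hik]
    by_cases h4 : (m : ℤ) - l = 0
    · have h3 : ¬ ((m : ℤ) + l = 0) := by omega
      rw [if_pos h4, if_neg h3]
      have hi : i ≠ 0 := by omega
      have hk : k ≠ 0 := by omega
      have : Real.cos (phase i - phase k) = 0 := by
        unfold phase
        by_cases hio : Odd i
        · have hko : ¬ Odd k := by
            intro hko; rcases hio with ⟨a, rfl⟩; rcases hko with ⟨b, rfl⟩; omega
          simp [hi, hk, hio, hko]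
        · have hko : Odd k := by
            by_contra hko
            rcases Nat.not_odd_iff_even.1 hio with ⟨a, rfl⟩
            rcases Nat.not_odd_iff_even.1 hko with ⟨b, rfl⟩; omega
          simp [hi, hk, hio, hko]
      simp [this]
    · have h3 : ¬ ((m : ℤ) + l = 0) := by omega
      rw [if_neg h4, if_neg h3]; simp

/-- The Fourier basis as elements of `L²[0, 1]`. -/
def fourierVec (k : ℕ) : Lp ℝ 2 unitMeasure := (memLp_fourierFun k).toLp (fourierFun k)

theorem orthonormal_fourierVec : Orthonormal ℝ fourierVec := by
  rw [orthonormal_iff_ite]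
  intro i k
  rw [L2.inner_def, ← integral_fourierFun_mul i k]
  refine integral_congr_ae ?_
  filter_upwards [(memLp_fourierFun i).coeFn_toLp, (memLp_fourierFun k).coeFn_toLp] with x h1 h2
  simp only [fourierVec, h1, h2]
  simp [mul_comm]

/-- Square summable sequences. -/
def SqSummable (θ : ℕ → ℝ) : Prop := Summable fun k => θ k ^ 2

theorem summable_smul_fourierVec_iff (θ : ℕ → ℝ) :
    Summable (fun k => θ k • fourierVec k) ↔ SqSummable θ := by
  have h := (orthonormal_fourierVec.orthogonalFamily).summable_iff_norm_sq_summable θ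
  simpa [LinearIsometry.toSpanSingleton_apply, SqSummable] using h

theorem SqSummable.summable_smul {θ : ℕ → ℝ} (h : SqSummable θ) :
    Summable (fun k => θ k • fourierVec k) := (summable_smul_fourierVec_iff θ).2 h

theorem fourierSum_eq (θ : ℕ → ℝ) : fourierSum θ = ∑' k, θ k • fourierVec k := rfl

theorem SqSummable.add {θ η : ℕ → ℝ} (h : SqSummable θ) (h' : SqSummable η) :
    SqSummable (θ + η) := by
  refine Summable.of_nonneg_of_le (fun k => sq_nonneg _) (fun k => ?_)
    ((h.mul_left 2).add (h'.mul_left 2))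
  simp only [Pi.add_apply]
  nlinarith [sq_nonneg (θ k - η k)]

theorem SqSummable.neg {θ : ℕ → ℝ} (h : SqSummable θ) : SqSummable (-θ) := by
  simpa [SqSummable] using h

theorem SqSummable.sub {θ η : ℕ → ℝ} (h : SqSummable θ) (h' : SqSummable η) :
    SqSummable (θ - η) := by
  rw [sub_eq_add_neg]; exact h.add h'.neg

theorem SqSummable.mono {θ η : ℕ → ℝ} (h : SqSummable θ) (h' : ∀ k, |η k| ≤ |θ k|) :
    SqSummable η :=
  Summable.of_nonneg_of_le (fun _ => sq_nonneg _) (fun k => sq_le_sq.2 (h' k)) h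

theorem sqSummable_of_finite {θ : ℕ → ℝ} (s : Finset ℕ) (h : ∀ k ∉ s, θ k = 0) : SqSummable θ :=
  summable_of_ne_finset_zero (s := s) fun k hk => by simp [h k hk]

theorem fourierSum_add {θ η : ℕ → ℝ} (h : SqSummable θ) (h' : SqSummable η) :
    fourierSum (θ + η) = fourierSum θ + fourierSum η := by
  simp only [fourierSum_eq, Pi.add_apply, add_smul]
  exact h.summable_smul.tsum_add h'.summable_smul

theorem fourierSum_neg (θ : ℕ → ℝ) : fourierSum (-θ) = -fourierSum θ := by
  simp only [fourierSum_eq, Pi.neg_apply, neg_smul, tsum_neg]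

theorem fourierSum_sub {θ η : ℕ → ℝ} (h : SqSummable θ) (h' : SqSummable η) :
    fourierSum (θ - η) = fourierSum θ - fourierSum η := by
  rw [sub_eq_add_neg, fourierSum_add h h'.neg, fourierSum_neg, sub_eq_add_neg]

theorem fourierSum_of_finite {θ : ℕ → ℝ} (s : Finset ℕ) (h : ∀ k ∉ s, θ k = 0) :
    fourierSum θ = ∑ k ∈ s, θ k • fourierVec k :=
  tsum_eq_sum fun k hk => by simp [h k hk]

theorem fourierSum_of_finite_ae {θ : ℕ → ℝ} (s : Finset ℕ) (h : ∀ k ∉ s, θ k = 0) :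
    fourierSum θ =ᵐ[unitMeasure] fun x => ∑ k ∈ s, θ k * fourierFun k x := by
  rw [fourierSum_of_finite s h]
  have h1 : ∀ᵐ x ∂unitMeasure, ∀ k, (θ k • fourierVec k : Lp ℝ 2 unitMeasure) x
      = θ k * fourierFun k x := by
    rw [ae_all_iff]; intro k
    filter_upwards [Lp.coeFn_smul (θ k) (fourierVec k), (memLp_fourierFun k).coeFn_toLp]
      with x hx hx'
    rw [hx, Pi.smul_apply, fourierVec, hx', smul_eq_mul]
  have h2 : ∀ t : Finset ℕ, ((∑ k ∈ t, θ k • fourierVec k : Lp ℝ 2 unitMeasure) : ℝ → ℝ)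
      =ᵐ[unitMeasure] fun x => ∑ k ∈ t, (θ k • fourierVec k : Lp ℝ 2 unitMeasure) x := by
    intro t
    induction t using Finset.induction_on with
    | empty =>
      filter_upwards [Lp.coeFn_zero ℝ 2 unitMeasure] with x hx
      simpa using hx
    | insert a t ha ih =>
      rw [Finset.sum_insert ha]
      filter_upwards [Lp.coeFn_add (θ a • fourierVec a) (∑ k ∈ t, θ k • fourierVec k), ih]
        with x hx hx'
      rw [hx, Pi.add_apply, hx', Finset.sum_insert ha]
  filter_upwards [h1, h2 s] with x hx hx'
  rw [hx']; exact Finset.sum_congr rfl fun k _ => hx k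

/-! ### The sup-norm -/

/-- The sup-norm on `[0, 1]` of the function with the given Fourier coefficients. -/
def supN (θ : ℕ → ℝ) : ℝ≥0∞ := eLpNorm (fourierSum θ) ∞ unitMeasure

theorem supDist_eq {θ η : ℕ → ℝ} (h : SqSummable θ) (h' : SqSummable η) :
    supDist (fourierSum θ) (fourierSum η) = supN (θ - η) := by
  rw [supDist, supN, fourierSum_sub h h']

theorem supN_neg (θ : ℕ → ℝ) : supN (-θ) = supN θ := by
  rw [supN, supN, fourierSum_neg, eLpNorm_congr_ae (Lp.coeFn_neg _), eLpNorm_neg]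

theorem supN_add_le {θ η : ℕ → ℝ} (h : SqSummable θ) (h' : SqSummable η) :
    supN (θ + η) ≤ supN θ + supN η := by
  rw [supN, supN, supN, fourierSum_add h h', eLpNorm_congr_ae (Lp.coeFn_add _ _)]
  exact eLpNorm_add_le (Lp.aestronglyMeasurable _) (Lp.aestronglyMeasurable _) le_top

theorem supN_sub_le {θ η : ℕ → ℝ} (h : SqSummable θ) (h' : SqSummable η) :
    supN (θ - η) ≤ supN θ + supN η := by
  rw [sub_eq_add_neg, ← supN_neg η]; exact supN_add_le h h'.neg

theorem eLpNorm_top_le_ofReal_iff {f : ℝ → ℝ} {r : ℝ} (hr : 0 ≤ r) :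
    eLpNorm f ∞ unitMeasure ≤ ENNReal.ofReal r ↔ ∀ᵐ x ∂unitMeasure, |f x| ≤ r := by
  rw [eLpNorm_exponent_top]
  constructor
  · intro h
    filter_upwards [ae_le_eLpNormEssSup (f := f) (μ := unitMeasure)] with x hx
    have := hx.trans h
    rwa [← ofReal_norm, ENNReal.ofReal_le_ofReal_iff hr, Real.norm_eq_abs] at this
  · intro h
    exact eLpNormEssSup_le_of_ae_bound h

theorem supN_le_ofReal_iff {θ : ℕ → ℝ} {r : ℝ} (hr : 0 ≤ r) :
    supN θ ≤ ENNReal.ofReal r ↔ ∀ᵐ x ∂unitMeasure, |fourierSum θ x| ≤ r :=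
  eLpNorm_top_le_ofReal_iff hr

theorem supN_of_finite_le {θ : ℕ → ℝ} (s : Finset ℕ) (h : ∀ k ∉ s, θ k = 0) {r : ℝ} (hr : 0 ≤ r)
    (hb : ∀ x ∈ Set.Icc (0 : ℝ) 1, |∑ k ∈ s, θ k * fourierFun k x| ≤ r) :
    supN θ ≤ ENNReal.ofReal r := by
  rw [supN_le_ofReal_iff hr]
  filter_upwards [fourierSum_of_finite_ae s h, ae_restrict_mem measurableSet_Icc] with x hx hx'
  rw [hx]; exact hb x hx'

theorem isClosed_setOf_eLpNorm_top_le (a : ℝ≥0∞) :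
    IsClosed {f : Lp ℝ 2 unitMeasure | eLpNorm f ∞ unitMeasure ≤ a} := by
  rw [← isSeqClosed_iff_isClosed]
  intro f g hf hg
  obtain ⟨ns, -, hns⟩ := (tendstoInMeasure_of_tendsto_Lp hg).exists_seq_tendsto_ae
  refine (Lp.eLpNorm_lim_le_liminf_eLpNorm (fun n => Lp.aestronglyMeasurable (f (ns n))) g hns).trans
    ?_
  refine (liminf_le_liminf (v := fun _ => a) (Eventually.of_forall fun n => hf (ns n))).trans ?_
  simp

/-- The truncation of a sequence to the first `m` entries. -/
def trunc (m : ℕ) (θ : ℕ → ℝ) : ℕ → ℝ := fun k => if k < m then θ k else 0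

theorem trunc_eq_zero {m : ℕ} {θ : ℕ → ℝ} : ∀ k ∉ Finset.range m, trunc m θ k = 0 := fun k hk => by
  simp only [Finset.mem_range] at hk; simp [trunc, hk]

theorem fourierSum_trunc (m : ℕ) (θ : ℕ → ℝ) :
    fourierSum (trunc m θ) = ∑ k ∈ Finset.range m, θ k • fourierVec k := by
  rw [fourierSum_of_finite (Finset.range m) trunc_eq_zero]
  refine Finset.sum_congr rfl fun k hk => ?_
  rw [trunc, if_pos (Finset.mem_range.1 hk)]

theorem tendsto_fourierSum_trunc {θ : ℕ → ℝ} (h : SqSummable θ) :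
    Tendsto (fun m => fourierSum (trunc m θ)) atTop (𝓝 (fourierSum θ)) := by
  simp_rw [fourierSum_trunc]
  exact h.summable_smul.hasSum.tendsto_sum_nat

theorem supN_le_of_trunc {θ : ℕ → ℝ} (h : SqSummable θ) {a : ℝ≥0∞} {ns : ℕ → ℕ}
    (hns : Tendsto ns atTop atTop) (ha : ∀ n, supN (trunc (ns n) θ) ≤ a) : supN θ ≤ a :=
  (isClosed_setOf_eLpNorm_top_le a).mem_of_tendsto
    ((tendsto_fourierSum_trunc h).comp hns) (Eventually.of_forall ha)

theorem supN_le_of_summable_abs {θ : ℕ → ℝ} (h : Summable fun k => |θ k|) :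
    supN θ ≤ ENNReal.ofReal (√2 * ∑' k, |θ k|) := by
  have hsq : SqSummable θ := by
    refine Summable.of_norm_bounded_eventually_nat h ?_
    filter_upwards [h.tendsto_atTop_zero.eventually (gt_mem_nhds one_pos)] with k hk
    rw [Real.norm_eq_abs, abs_pow, pow_two]
    exact mul_le_of_le_one_right (abs_nonneg _) hk.le
  refine supN_le_of_trunc hsq tendsto_id fun m => ?_
  refine supN_of_finite_le (Finset.range m) trunc_eq_zero
    (mul_nonneg (Real.sqrt_nonneg _) (tsum_nonneg fun _ => abs_nonneg _)) fun x _ => ?_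
  refine (Finset.abs_sum_le_sum_abs _ _).trans ?_
  calc ∑ k ∈ Finset.range m, |trunc m θ k * fourierFun k x|
      ≤ ∑ k ∈ Finset.range m, √2 * |θ k| := by
        refine Finset.sum_le_sum fun k hk => ?_
        rw [abs_mul, mul_comm, trunc, if_pos (Finset.mem_range.1 hk)]
        exact mul_le_mul_of_nonneg_right (abs_fourierFun_le k x) (abs_nonneg _)
    _ = √2 * ∑ k ∈ Finset.range m, |θ k| := by rw [Finset.mul_sum]
    _ ≤ √2 * ∑' k, |θ k| := by
        gcongr
        exact h.sum_le_tsum _ fun _ _ => abs_nonneg _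

theorem measurableSet_sqSummable : MeasurableSet {θ : ℕ → ℝ | SqSummable θ} := by
  have : {θ : ℕ → ℝ | SqSummable θ} = {θ | ∑' k, ENNReal.ofReal (θ k ^ 2) ≠ ∞} := by
    ext θ
    constructor
    · intro h; exact Summable.tsum_ofReal_ne_top h
    · intro h
      have := ENNReal.summable_toReal h
      simpa [SqSummable, ENNReal.toReal_ofReal (sq_nonneg _)] using this
  rw [this]
  have hm : Measurable fun θ : ℕ → ℝ => ∑' k, ENNReal.ofReal (θ k ^ 2) := by fun_prop
  exact (hm (measurableSet_singleton ∞)).compl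

theorem stronglyMeasurable_fourierSum : StronglyMeasurable fourierSum := by
  refine stronglyMeasurable_of_tendsto atTop
    (f := fun (m : ℕ) => Set.indicator {θ : ℕ → ℝ | SqSummable θ}
      fun θ => fourierSum (trunc m θ)) (fun m => ?_) ?_
  · refine StronglyMeasurable.indicator ?_ measurableSet_sqSummable
    simp_rw [fourierSum_trunc]
    refine Finset.stronglyMeasurable_fun_sum _ fun k _ => ?_
    exact (measurable_pi_apply k).stronglyMeasurable.smul_const _
  · rw [tendsto_pi_nhds]
    intro θ
    by_cases h : SqSummable θ
    · simpa [Set.indicator, h] using tendsto_fourierSum_trunc h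
    · have : fourierSum θ = 0 := by
        rw [fourierSum_eq]
        exact tsum_eq_zero_of_not_summable fun hs => h ((summable_smul_fourierVec_iff θ).1 hs)
      simp [Set.indicator, h, this]

theorem measurableSet_setOf_supDist_le (g : Lp ℝ 2 unitMeasure) (a : ℝ≥0∞) :
    MeasurableSet {θ | supDist (fourierSum θ) g ≤ a} := by
  borelize ↥(Lp ℝ 2 unitMeasure)
  have hc : IsClosed {f : Lp ℝ 2 unitMeasure | eLpNorm (f - g : Lp ℝ 2 unitMeasure) ∞ unitMeasure ≤ a} :=
    (isClosed_setOf_eLpNorm_top_le a).preimage (continuous_id.sub continuous_const)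
  exact stronglyMeasurable_fourierSum.measurable hc.measurableSet

theorem measurable_supN : Measurable supN := by
  borelize ↥(Lp ℝ 2 unitMeasure)
  refine measurable_of_Iic fun a => ?_
  exact stronglyMeasurable_fourierSum.measurable (isClosed_setOf_eLpNorm_top_le a).measurableSet

/-- A sequence whose only nonzero entry is the first one, the coefficient of the constant `1`. -/
def constSeq (t : ℝ) : ℕ → ℝ := fun k => if k = 0 then t else 0

theorem constSeq_eq_zero {t : ℝ} : ∀ k ∉ ({0} : Finset ℕ), constSeq t k = 0 := fun k hk => by
  simp only [Finset.mem_singleton] at hk; simp [constSeq, hk]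

theorem sqSummable_constSeq (t : ℝ) : SqSummable (constSeq t) :=
  sqSummable_of_finite {0} constSeq_eq_zero

theorem fourierSum_constSeq_add (t : ℝ) {θ : ℕ → ℝ} (h : SqSummable θ) :
    fourierSum (constSeq t + θ) =ᵐ[unitMeasure] fun x => t + fourierSum θ x := by
  rw [fourierSum_add (sqSummable_constSeq t) h]
  filter_upwards [Lp.coeFn_add (fourierSum (constSeq t)) (fourierSum θ),
    fourierSum_of_finite_ae {0} (constSeq_eq_zero (t := t))] with x hx hx'
  rw [hx, Pi.add_apply, hx']
  simp [constSeq, fourierFun]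

instance : NeZero unitMeasure := ⟨by
  intro h
  have := congrArg (fun μ : Measure ℝ => μ Set.univ) h
  simp at this⟩

theorem supN_constSeq (t : ℝ) : supN (constSeq t) = ENNReal.ofReal |t| := by
  have h : fourierSum (constSeq t) =ᵐ[unitMeasure] fun _ => t := by
    filter_upwards [fourierSum_of_finite_ae {0} (constSeq_eq_zero (t := t))] with x hx'
    rw [hx']; simp [constSeq, fourierFun]
  rw [supN, eLpNorm_congr_ae h, eLpNorm_exponent_top, eLpNormEssSup_const _ (NeZero.ne _),
    ← ofReal_norm, Real.norm_eq_abs]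

theorem ofReal_abs_le_supN_add {t : ℝ} {θ : ℕ → ℝ} (h : SqSummable θ) :
    ENNReal.ofReal |t| ≤ supN (constSeq t + θ) + supN θ := by
  rw [← supN_constSeq]
  have := supN_sub_le ((sqSummable_constSeq t).add h) h
  rwa [add_sub_cancel_right] at this

/-- Shifting a function by constants, each value `r` of the sup-norm is attained at most twice. -/
theorem not_three_shifts {θ : ℕ → ℝ} (h : SqSummable θ) {r t₁ t₂ t₃ : ℝ} (hr : 0 ≤ r)
    (h12 : t₁ < t₂) (h23 : t₂ < t₃) (h1 : supN (constSeq t₁ + θ) ≤ ENNReal.ofReal r)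
    (h3 : supN (constSeq t₃ + θ) ≤ ENNReal.ofReal r) :
    supN (constSeq t₂ + θ) < ENNReal.ofReal r := by
  set d := min (t₂ - t₁) (t₃ - t₂)
  have hd0 : 0 < d := lt_min (by linarith) (by linarith)
  rw [supN_le_ofReal_iff hr] at h1 h3
  have hall : ∀ᵐ x ∂unitMeasure, |fourierSum (constSeq t₂ + θ) x| ≤ r - d := by
    filter_upwards [h1, h3, fourierSum_constSeq_add t₁ h, fourierSum_constSeq_add t₂ h,
      fourierSum_constSeq_add t₃ h] with x a1 a3 e1 e2 e3
    rw [e1, abs_le] at a1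
    rw [e3, abs_le] at a3
    rw [e2, abs_le]
    have := min_le_left (t₂ - t₁) (t₃ - t₂)
    have := min_le_right (t₂ - t₁) (t₃ - t₂)
    constructor <;> linarith
  have hrd : 0 ≤ r - d := by
    obtain ⟨x, hx⟩ := hall.exists
    exact (abs_nonneg _).trans hx
  refine ((supN_le_ofReal_iff hrd).2 hall).trans_lt ?_
  exact (ENNReal.ofReal_lt_ofReal_iff (by linarith)).2 (by linarith)

/-! ### Rotations of the noise -/

theorem charFunDual_gaussianReal_zero_one (L : StrongDual ℝ ℝ) :
    charFunDual (gaussianReal 0 1) L = Complex.exp (-((L 1 ^ 2 : ℝ) : ℂ) / 2) := by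
  rw [charFunDual_eq_charFun_map_one, gaussianReal_map_continuousLinearMap, charFun_gaussianReal]
  congr 1
  simp [Real.coe_toNNReal _ (sq_nonneg _)]
  ring

theorem gaussianReal_prod_map_rotate {a b : ℝ} (h : a ^ 2 + b ^ 2 = 1) :
    ((gaussianReal 0 1).prod (gaussianReal 0 1)).map
      (fun p : ℝ × ℝ => (a * p.1 + b * p.2, b * p.1 - a * p.2)) =
      (gaussianReal 0 1).prod (gaussianReal 0 1) := by
  set T : ℝ × ℝ →L[ℝ] ℝ × ℝ :=
    (a • ContinuousLinearMap.fst ℝ ℝ ℝ + b • ContinuousLinearMap.snd ℝ ℝ ℝ).prod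
      (b • ContinuousLinearMap.fst ℝ ℝ ℝ - a • ContinuousLinearMap.snd ℝ ℝ ℝ) with hT
  have hTeq : (fun p : ℝ × ℝ => (a * p.1 + b * p.2, b * p.1 - a * p.2)) = T := by
    ext p <;> simp [hT]
  rw [hTeq]
  refine Measure.ext_of_charFunDual (funext fun L => ?_)
  rw [charFunDual_map, charFunDual_prod, charFunDual_prod]
  simp only [charFunDual_gaussianReal_zero_one, ← Complex.exp_add]
  congr 1
  have hL : ∀ x y : ℝ, L (x, y) = x * L (1, 0) + y * L (0, 1) := fun x y => by
    have : ((x, y) : ℝ × ℝ) = x • (1, 0) + y • (0, 1) := by simp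
    rw [this, map_add, map_smul, map_smul, smul_eq_mul, smul_eq_mul]
  simp only [ContinuousLinearMap.comp_apply, ContinuousLinearMap.inl_apply,
    ContinuousLinearMap.inr_apply]
  have h1 : T (1, 0) = (a, b) := by simp [hT]
  have h2 : T (0, 1) = (b, -a) := by simp [hT]
  rw [h1, h2, hL a b, hL b (-a)]
  have hreal : (a * L (1, 0) + b * L (0, 1)) ^ 2 + (b * L (1, 0) + -a * L (0, 1)) ^ 2 =
      L (1, 0) ^ 2 + L (0, 1) ^ 2 := by
    linear_combination (L (1, 0) ^ 2 + L (0, 1) ^ 2) * h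
  have hc := congrArg (fun x : ℝ => (x : ℂ)) hreal
  push_cast at hc ⊢
  linear_combination (-1 / 2 : ℂ) * hc

theorem noise_prod_map_zip :
    (noise.prod noise).map (fun (p : (ℕ → ℝ) × (ℕ → ℝ)) (k : ℕ) => (p.1 k, p.2 k)) =
      Measure.infinitePi fun _ => (gaussianReal 0 1).prod (gaussianReal 0 1) := by
  refine IsProjectiveLimit.unique (P := fun I : Finset ℕ => Measure.pi fun _ : I =>
    (gaussianReal 0 1).prod (gaussianReal 0 1)) (fun I => ?_)
    (Measure.isProjectiveLimit_infinitePi _)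
  rw [Measure.map_map (by fun_prop) (by fun_prop)]
  beta_reduce
  rw [← ((measurePreserving_arrowProdEquivProdArrow ℝ ℝ I (fun _ => gaussianReal 0 1)
      fun _ => gaussianReal 0 1).symm).map_eq,
    ← Measure.infinitePi_map_restrict (fun _ : ℕ => gaussianReal 0 1) (I := I),
    Measure.map_prod_map _ _ (by fun_prop) (by fun_prop), Measure.map_map (by fun_prop) (by fun_prop)]
  rfl

/-- Coordinatewise rotations preserve the law of two independent noise sequences. -/
theorem noise_prod_map_rotate {a b : ℕ → ℝ} (h : ∀ k, a k ^ 2 + b k ^ 2 = 1) :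
    (noise.prod noise).map (fun p : (ℕ → ℝ) × (ℕ → ℝ) =>
      (fun k => a k * p.1 k + b k * p.2 k, fun k => b k * p.1 k - a k * p.2 k)) =
      noise.prod noise := by
  have hz : Measurable fun (p : (ℕ → ℝ) × (ℕ → ℝ)) (k : ℕ) => (p.1 k, p.2 k) := by fun_prop
  have hu : Measurable fun q : ℕ → ℝ × ℝ => ((fun k => (q k).1, fun k => (q k).2) :
      (ℕ → ℝ) × (ℕ → ℝ)) := by fun_prop
  have hrot : ∀ k, Measurable fun p : ℝ × ℝ => (a k * p.1 + b k * p.2, b k * p.1 - a k * p.2) :=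
    fun k => by fun_prop
  have key := Measure.infinitePi_map_pi
    (fun _ : ℕ => (gaussianReal 0 1).prod (gaussianReal 0 1)) hrot
  simp_rw [gaussianReal_prod_map_rotate (h _)] at key
  rw [← noise_prod_map_zip, Measure.map_map (by fun_prop) hz] at key
  have key2 := congrArg (Measure.map (fun q : ℕ → ℝ × ℝ => ((fun k => (q k).1, fun k => (q k).2) :
      (ℕ → ℝ) × (ℕ → ℝ)))) key
  rw [Measure.map_map hu (by fun_prop), Measure.map_map hu hz] at key2
  refine key2.trans ?_
  exact Measure.map_id

/-- A noise sequence can be split coordinatewise into two independent parts. -/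
theorem noise_prod_map_add {a b : ℕ → ℝ} (h : ∀ k, a k ^ 2 + b k ^ 2 = 1) :
    (noise.prod noise).map (fun (p : (ℕ → ℝ) × (ℕ → ℝ)) k => a k * p.1 k + b k * p.2 k) =
      noise := by
  have h1 := congrArg (Measure.map Prod.fst) (noise_prod_map_rotate h)
  rw [Measure.map_map (by fun_prop) (by fun_prop), ← Measure.fst, Measure.fst_prod] at h1
  exact h1

theorem noise_map_eval (k : ℕ) : noise.map (fun z => z k) = gaussianReal 0 1 :=
  Measure.infinitePi_map_eval _ k

theorem lintegral_sq_noise (k : ℕ) : ∫⁻ z, ENNReal.ofReal (z k ^ 2) ∂noise = 1 := by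
  have h1 : ∫⁻ z, ENNReal.ofReal (z k ^ 2) ∂noise =
      ∫⁻ x, ENNReal.ofReal (x ^ 2) ∂gaussianReal 0 1 := by
    rw [← noise_map_eval k, lintegral_map (by fun_prop) (by fun_prop)]
  have h2 : ∫ x, x ^ 2 ∂gaussianReal 0 1 = 1 := by
    have := variance_fun_id_gaussianReal (μ := 0) (v := 1)
    rw [variance_of_integral_eq_zero (by fun_prop) (by simp)] at this
    simpa using this
  rw [h1, ← ofReal_integral_eq_lintegral_ofReal
    (f := fun x : ℝ => x ^ 2) (memLp_id_gaussianReal 2).integrable_sq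
    (ae_of_all _ fun x => sq_nonneg _), h2, ENNReal.ofReal_one]

/-- Weighted noise sequences with square summable weights are almost surely square summable. -/
theorem ae_sqSummable_mul {σ : ℕ → ℝ} (h : SqSummable σ) :
    ∀ᵐ z ∂noise, SqSummable fun k => σ k * z k := by
  have hfin : ∫⁻ z, ∑' k, ENNReal.ofReal ((σ k * z k) ^ 2) ∂noise ≠ ∞ := by
    rw [lintegral_tsum fun k => Measurable.aemeasurable
      (((measurable_pi_apply k).const_mul (σ k)).pow_const 2).ennreal_ofReal]
    have : ∀ k, ∫⁻ z, ENNReal.ofReal ((σ k * z k) ^ 2) ∂noise = ENNReal.ofReal (σ k ^ 2) := by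
      intro k
      simp_rw [mul_pow, ENNReal.ofReal_mul (sq_nonneg (σ k))]
      rw [lintegral_const_mul _ (by fun_prop), lintegral_sq_noise, mul_one]
    simp_rw [this]
    exact Summable.tsum_ofReal_ne_top h
  filter_upwards [ae_lt_top (by fun_prop) hfin] with z hz
  have := ENNReal.summable_toReal hz.ne
  simpa [SqSummable, ENNReal.toReal_ofReal (sq_nonneg _)] using this

/-! ### Maximal inequalities -/

theorem hasSubgaussianMGF_noise (k : ℕ) : HasSubgaussianMGF (fun z : ℕ → ℝ => z k) 1 noise := by
  refine (HasSubgaussianMGF.id_map_iff (measurable_pi_apply k).aemeasurable).1 ?_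
  rw [noise_map_eval]
  exact ⟨fun t => integrable_exp_mul_gaussianReal t, fun t => by simp [mgf_id_gaussianReal]⟩

theorem noise_abs_sum_ge_le (B : Finset ℕ) (c : ℕ → ℝ) {v w : ℝ} (hv : 0 < v)
    (hc : ∑ k ∈ B, c k ^ 2 ≤ v) (hw : 0 ≤ w) :
    noise {z | w * √v ≤ |∑ k ∈ B, c k * z k|} ≤ ENNReal.ofReal (2 * Real.exp (-w ^ 2 / 2)) := by
  have hind : iIndepFun (fun (k : ℕ) (z : ℕ → ℝ) => c k * z k) noise :=
    iIndepFun_infinitePi (X := fun k x => c k * x) fun k => measurable_const_mul (c k)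
  have hk : ∀ k ∈ B, HasSubgaussianMGF (fun z : ℕ → ℝ => c k * z k) (c k ^ 2).toNNReal noise := by
    intro k _
    convert (hasSubgaussianMGF_noise k).const_mul (c k) using 1
    refine NNReal.eq ((Real.coe_toNNReal _ (sq_nonneg _)).trans ?_)
    exact (mul_one (c k ^ 2)).symm
  have hsum := HasSubgaussianMGF.sum_of_iIndepFun hind hk
  set V : ℝ≥0 := v.toNNReal
  have hVv : (V : ℝ) = v := Real.coe_toNNReal v hv.le
  have hS : HasSubgaussianMGF (fun z : ℕ → ℝ => ∑ k ∈ B, c k * z k) V noise := by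
    refine ⟨hsum.1, fun t => (hsum.2 t).trans ?_⟩
    rw [Real.exp_le_exp]
    have : ((∑ k ∈ B, (c k ^ 2).toNNReal : ℝ≥0) : ℝ) ≤ V := by
      push_cast
      simpa [hVv, Real.coe_toNNReal _ (sq_nonneg _)] using hc
    gcongr
  have hw' : 0 ≤ w * √v := mul_nonneg hw (Real.sqrt_nonneg _)
  have h1 := hS.measure_ge_le hw'
  have h2 := hS.neg.measure_ge_le hw'
  have hexp : -(w * √v) ^ 2 / (2 * (V : ℝ)) = -w ^ 2 / 2 := by
    rw [hVv, mul_pow, Real.sq_sqrt hv.le]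
    field_simp
  rw [hexp] at h1 h2
  have hsub : {z : ℕ → ℝ | w * √v ≤ |∑ k ∈ B, c k * z k|} ⊆
      {z | w * √v ≤ ∑ k ∈ B, c k * z k} ∪ {z | w * √v ≤ (-fun z => ∑ k ∈ B, c k * z k) z} := by
    intro z hz
    rw [Set.mem_ofPred_eq] at hz
    rcases le_abs.1 hz with h | h
    · exact Or.inl h
    · exact Or.inr (by simpa using h)
  refine (measure_mono hsub).trans ((measure_union_le _ _).trans ?_)
  rw [two_mul, ENNReal.ofReal_add (Real.exp_pos _).le (Real.exp_pos _).le]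
  refine add_le_add ?_ ?_
  · rw [← ENNReal.ofReal_toReal (measure_ne_top noise _)]
    exact ENNReal.ofReal_le_ofReal h1
  · rw [← ENNReal.ofReal_toReal (measure_ne_top noise _)]
    exact ENNReal.ofReal_le_ofReal h2

theorem noise_abs_ge_le (k : ℕ) {w : ℝ} (hw : 0 ≤ w) :
    noise {z | w ≤ |z k|} ≤ ENNReal.ofReal (2 * Real.exp (-w ^ 2 / 2)) := by
  simpa using noise_abs_sum_ge_le {k} (fun _ => 1) one_pos (by simp) hw

/-- The restriction of a sequence to a set of indices. -/
def restr (B : Finset ℕ) (θ : ℕ → ℝ) : ℕ → ℝ := fun k => if k ∈ B then θ k else 0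

theorem restr_eq_zero {B : Finset ℕ} {θ : ℕ → ℝ} : ∀ k ∉ B, restr B θ k = 0 := fun k hk => by
  simp [restr, hk]

theorem sqSummable_restr (B : Finset ℕ) (θ : ℕ → ℝ) : SqSummable (restr B θ) :=
  sqSummable_of_finite B restr_eq_zero

theorem restr_range (m : ℕ) (θ : ℕ → ℝ) : restr (Finset.range m) θ = trunc m θ := by
  ext k; simp [restr, trunc]

/-- A trigonometric polynomial is controlled by its values on a grid and its coefficients. -/
theorem abs_sum_fourierFun_le_of_grid {B : Finset ℕ} {K : ℕ} (hK : 1 ≤ K)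
    (hB : ∀ k ∈ B, k < K) {σ z : ℕ → ℝ} {v w : ℝ} (hv : 0 < v) (hσ : ∑ k ∈ B, σ k ^ 2 ≤ v)
    (hw : 0 ≤ w)
    (hgrid : ∀ j ∈ Finset.range (K ^ 2 + 1),
      |∑ k ∈ B, σ k * fourierFun k (j / K ^ 2) * z k| ≤ w * √(2 * v))
    (hz : ∀ k ∈ Finset.range K, |z k| ≤ w) {x : ℝ} (hx : x ∈ Set.Icc (0 : ℝ) 1) :
    |∑ k ∈ B, σ k * z k * fourierFun k x| ≤ 12 * √v * w := by
  have hKr : (0 : ℝ) < K := by exact_mod_cast hK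
  set j : ℕ := ⌊x * K ^ 2⌋₊
  have hj1 : (j : ℝ) ≤ x * K ^ 2 := Nat.floor_le (mul_nonneg hx.1 (by positivity))
  have hj2 : x * K ^ 2 < j + 1 := Nat.lt_floor_add_one _
  have hjr : j ∈ Finset.range (K ^ 2 + 1) := by
    rw [Finset.mem_range, Nat.lt_succ_iff]
    have : (j : ℝ) ≤ (K ^ 2 : ℕ) := by
      push_cast
      exact hj1.trans (mul_le_of_le_one_left (by positivity) hx.2)
    exact_mod_cast this
  set y : ℝ := j / K ^ 2 with hy
  have hxy : |x - y| ≤ 1 / K ^ 2 := by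
    rw [abs_le, hy]
    constructor
    · have : (j : ℝ) / K ^ 2 ≤ x := by rw [div_le_iff₀ (by positivity)]; exact hj1
      have : (0 : ℝ) ≤ 1 / K ^ 2 := by positivity
      linarith
    · rw [sub_le_iff_le_add, ← add_div, le_div_iff₀ (by positivity)]; linarith
  have hsplit : ∑ k ∈ B, σ k * z k * fourierFun k x =
      ∑ k ∈ B, σ k * fourierFun k y * z k +
        ∑ k ∈ B, σ k * z k * (fourierFun k x - fourierFun k y) := by
    rw [← Finset.sum_add_distrib]; exact Finset.sum_congr rfl fun k _ => by ring
  have hl1 : ∑ k ∈ B, |σ k| ≤ √K * √v := by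
    have h1 : (∑ k ∈ B, |σ k|) ^ 2 ≤ K * v := by
      have hcs := sq_sum_le_card_mul_sum_sq (s := B) (f := fun k => |σ k|)
      simp only [sq_abs] at hcs
      refine hcs.trans ?_
      have hcard : (B.card : ℝ) ≤ K := by
        have : B ⊆ Finset.range K := fun k hk => Finset.mem_range.2 (hB k hk)
        have := Finset.card_le_card this
        rw [Finset.card_range] at this
        exact_mod_cast this
      exact mul_le_mul hcard hσ (Finset.sum_nonneg fun _ _ => sq_nonneg _) hKr.le
    rw [← Real.sqrt_mul hKr.le]
    exact Real.le_sqrt_of_sq_le h1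
  have herr : |∑ k ∈ B, σ k * z k * (fourierFun k x - fourierFun k y)| ≤
      √2 * (2 * Real.pi) * w * √v := by
    refine (Finset.abs_sum_le_sum_abs _ _).trans ?_
    calc ∑ k ∈ B, |σ k * z k * (fourierFun k x - fourierFun k y)|
        ≤ ∑ k ∈ B, |σ k| * (w * (√2 * (2 * Real.pi * K) * (1 / K ^ 2))) := by
          refine Finset.sum_le_sum fun k hk => ?_
          rw [abs_mul, abs_mul, mul_assoc]
          refine mul_le_mul_of_nonneg_left ?_ (abs_nonneg _)
          refine mul_le_mul (hz k (Finset.mem_range.2 (hB k hk))) ?_ (abs_nonneg _) hw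
          refine (abs_fourierFun_sub_le k x y).trans ?_
          have : ((k : ℝ) + 1) ≤ K := by exact_mod_cast hB k hk
          gcongr
      _ = (√2 * (2 * Real.pi) * w) * ((1 / K) * ∑ k ∈ B, |σ k|) := by
          rw [← Finset.sum_mul]; field_simp
      _ ≤ (√2 * (2 * Real.pi) * w) * √v := by
          refine mul_le_mul_of_nonneg_left ?_ (by positivity)
          refine (mul_le_mul_of_nonneg_left hl1 (by positivity)).trans ?_
          rw [← mul_assoc]
          refine mul_le_of_le_one_left (Real.sqrt_nonneg _) ?_
          rw [one_div, inv_mul_le_iff₀ hKr, mul_one, Real.sqrt_le_left hKr.le]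
          have : (1 : ℝ) ≤ K := by exact_mod_cast hK
          nlinarith
  rw [hsplit]
  refine (abs_add_le _ _).trans ((add_le_add (hgrid j hjr) herr).trans ?_)
  have h2 : √2 ≤ 1.4143 := by
    rw [Real.sqrt_le_left (by norm_num)]; norm_num
  have hπ : Real.pi ≤ 3.15 := Real.pi_lt_d2.le
  have hprod : √2 * (1 + 2 * Real.pi) ≤ 12 := by
    calc √2 * (1 + 2 * Real.pi) ≤ 1.4143 * (1 + 2 * 3.15) := by gcongr
      _ ≤ 12 := by norm_num
  rw [Real.sqrt_mul zero_le_two]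
  calc w * (√2 * √v) + √2 * (2 * Real.pi) * w * √v = (√2 * (1 + 2 * Real.pi)) * (√v * w) := by ring
    _ ≤ 12 * (√v * w) := by gcongr
    _ = 12 * √v * w := by ring

theorem noise_supN_restr_gt_le {B : Finset ℕ} {K : ℕ} (hK : 1 ≤ K) (hB : ∀ k ∈ B, k < K)
    {σ : ℕ → ℝ} {v w : ℝ} (hv : 0 < v) (hσ : ∑ k ∈ B, σ k ^ 2 ≤ v) (hw : 0 ≤ w) :
    noise {z | ENNReal.ofReal (12 * √v * w) < supN (restr B fun k => σ k * z k)} ≤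
      ENNReal.ofReal (6 * K ^ 2 * Real.exp (-w ^ 2 / 2)) := by
  set e := Real.exp (-w ^ 2 / 2)
  have he0 : 0 < e := Real.exp_pos _
  have hsub : {z : ℕ → ℝ | ENNReal.ofReal (12 * √v * w) < supN (restr B fun k => σ k * z k)} ⊆
      (⋃ j ∈ Finset.range (K ^ 2 + 1),
        {z : ℕ → ℝ | w * √(2 * v) ≤ |∑ k ∈ B, σ k * fourierFun k (j / K ^ 2) * z k|}) ∪
      ⋃ k ∈ Finset.range K, {z : ℕ → ℝ | w ≤ |z k|} := by
    intro z hz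
    by_contra hcon
    simp only [Set.mem_union, Set.mem_iUnion, not_or, not_exists] at hcon
    rw [Set.mem_ofPred_eq] at hz
    refine absurd hz (not_lt.2 ?_)
    refine supN_of_finite_le B restr_eq_zero (by positivity) fun x hx => ?_
    have : ∑ k ∈ B, restr B (fun k => σ k * z k) k * fourierFun k x =
        ∑ k ∈ B, σ k * z k * fourierFun k x :=
      Finset.sum_congr rfl fun k hk => by simp [restr, hk]
    rw [this]
    exact abs_sum_fourierFun_le_of_grid hK hB hv hσ hw
      (fun j hj => (not_le.1 (hcon.1 j hj)).le) (fun k hk => (not_le.1 (hcon.2 k hk)).le) hx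
  refine (measure_mono hsub).trans ((measure_union_le _ _).trans ?_)
  have hvar : ∀ x, ∑ k ∈ B, (σ k * fourierFun k x) ^ 2 ≤ 2 * v := fun x => by
    calc ∑ k ∈ B, (σ k * fourierFun k x) ^ 2 ≤ ∑ k ∈ B, 2 * σ k ^ 2 := by
          refine Finset.sum_le_sum fun k _ => ?_
          have h := sq_le_sq.2 ((abs_fourierFun_le k x).trans (le_abs_self _))
          rw [Real.sq_sqrt zero_le_two] at h
          rw [mul_pow, mul_comm]
          exact mul_le_mul_of_nonneg_right h (sq_nonneg _)
      _ ≤ 2 * v := by rw [← Finset.mul_sum]; gcongr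
  have h1 : noise (⋃ j ∈ Finset.range (K ^ 2 + 1),
      {z : ℕ → ℝ | w * √(2 * v) ≤ |∑ k ∈ B, σ k * fourierFun k (j / K ^ 2) * z k|}) ≤
      ENNReal.ofReal ((K ^ 2 + 1) * (2 * e)) := by
    refine (measure_biUnion_finset_le _ _).trans ?_
    refine (Finset.sum_le_sum fun (j : ℕ) _ => noise_abs_sum_ge_le B _ (by positivity)
      (hvar (j / K ^ 2)) hw).trans ?_
    rw [Finset.sum_const, Finset.card_range, nsmul_eq_mul, ← ENNReal.ofReal_natCast,
      ← ENNReal.ofReal_mul (by positivity)]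
    push_cast; rfl
  have h2 : noise (⋃ k ∈ Finset.range K, {z : ℕ → ℝ | w ≤ |z k|}) ≤
      ENNReal.ofReal (K * (2 * e)) := by
    refine (measure_biUnion_finset_le _ _).trans ?_
    refine (Finset.sum_le_sum fun k _ => noise_abs_ge_le k hw).trans ?_
    rw [Finset.sum_const, Finset.card_range, nsmul_eq_mul, ENNReal.ofReal_mul (by positivity) (q := 2 * e),
      ENNReal.ofReal_natCast]
  refine (add_le_add h1 h2).trans ?_
  rw [← ENNReal.ofReal_add (by positivity) (by positivity)]
  refine ENNReal.ofReal_le_ofReal ?_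
  have hK1 : (1 : ℝ) ≤ K := by exact_mod_cast hK
  have hK2 : (K : ℝ) ≤ K ^ 2 := by nlinarith
  nlinarith

/-! ### Polynomially decaying weights -/

theorem sum_Ico_rpow_le {p : ℝ} (hp : 0 < p) {a : ℕ} (ha : 1 ≤ a) (b : ℕ) :
    ∑ k ∈ Finset.Ico a b, ((k : ℝ) + 1) ^ (-(p + 1)) ≤ (a : ℝ) ^ (-p) / p := by
  have hstep : ∀ k : ℕ, 1 ≤ k → ((k : ℝ) + 1) ^ (-(p + 1)) ≤
      (k : ℝ) ^ (-p) / p - ((k + 1 : ℕ) : ℝ) ^ (-p) / p := by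
    intro k hk
    have hk1 : (0 : ℝ) < k + 1 := by positivity
    push_cast
    rw [← sub_div, le_div_iff₀ hp, neg_add, Real.rpow_add hk1, Real.rpow_neg_one, mul_assoc,
      le_sub_iff_add_le]
    have hx : (k : ℝ) ^ (-p) = ((k : ℝ) + 1) ^ (-p) * (k / (k + 1)) ^ (-p) := by
      rw [← Real.mul_rpow hk1.le (by positivity)]; congr 1; field_simp
    rw [hx]
    have hexp : 1 + ((k : ℝ) + 1)⁻¹ * p ≤ (k / (k + 1) : ℝ) ^ (-p) := by
      rw [Real.rpow_def_of_pos (by positivity)]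
      have hlog : Real.log ((k : ℝ) / (k + 1)) ≤ -((k : ℝ) + 1)⁻¹ := by
        refine (Real.log_le_sub_one_of_pos (by positivity)).trans (le_of_eq ?_)
        field_simp; ring
      refine le_trans ?_ (Real.add_one_le_exp _)
      nlinarith
    have hpos : 0 < ((k : ℝ) + 1) ^ (-p) := Real.rpow_pos_of_pos hk1 _
    nlinarith
  rcases le_total a b with hab | hab
  · calc ∑ k ∈ Finset.Ico a b, ((k : ℝ) + 1) ^ (-(p + 1))
        ≤ ∑ k ∈ Finset.Ico a b, ((k : ℝ) ^ (-p) / p - ((k + 1 : ℕ) : ℝ) ^ (-p) / p) :=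
          Finset.sum_le_sum fun k hk => hstep k (ha.trans (Finset.mem_Ico.1 hk).1)
      _ = (a : ℝ) ^ (-p) / p - (b : ℝ) ^ (-p) / p := by
          have := Finset.sum_Ico_sub (fun k : ℕ => -((k : ℝ) ^ (-p) / p)) hab
          simp only [sub_neg_eq_add, neg_add_eq_sub] at this
          exact this
      _ ≤ (a : ℝ) ^ (-p) / p := by
          rw [sub_le_self_iff]; positivity
  · rw [Finset.Ico_eq_empty_of_le hab, Finset.sum_empty]; positivity

theorem sum_min_rpow_le {p : ℝ} (hp : 0 < p) {n : ℕ} (hn : 1 ≤ n) (N : ℕ) :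
    ∑ k ∈ Finset.range N, min ((n : ℝ)⁻¹) (((k : ℝ) + 1) ^ (-(p + 1))) ≤
      (2 + 1 / p) * (n : ℝ) ^ (-p / (p + 1)) := by
  have hn1 : (1 : ℝ) ≤ n := by exact_mod_cast hn
  have hn0 : (0 : ℝ) < n := by positivity
  set J : ℝ := (n : ℝ) ^ (1 / (p + 1)) with hJ
  have hJ1 : 1 ≤ J := Real.one_le_rpow hn1 (by positivity)
  have hJp : J ^ (-p) = (n : ℝ) ^ (-p / (p + 1)) := by
    rw [hJ, ← Real.rpow_mul hn0.le]; congr 1; ring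
  have hJn : J * (n : ℝ)⁻¹ = J ^ (-p) := by
    rw [hJp, hJ, ← Real.rpow_neg_one, ← Real.rpow_add hn0]; congr 1; field_simp; ring
  set a := ⌈J⌉₊
  have ha1 : 1 ≤ a := Nat.one_le_ceil_iff.2 (by positivity)
  have hnn : ∀ k : ℕ, 0 ≤ min ((n : ℝ)⁻¹) (((k : ℝ) + 1) ^ (-(p + 1))) := fun k =>
    le_min (by positivity) (by positivity)
  calc ∑ k ∈ Finset.range N, min ((n : ℝ)⁻¹) (((k : ℝ) + 1) ^ (-(p + 1)))
      ≤ ∑ k ∈ Finset.range (max a N), min ((n : ℝ)⁻¹) (((k : ℝ) + 1) ^ (-(p + 1))) :=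
        Finset.sum_le_sum_of_subset_of_nonneg (Finset.range_mono (le_max_right _ _))
          fun k _ _ => hnn k
    _ = ∑ k ∈ Finset.range a, min ((n : ℝ)⁻¹) (((k : ℝ) + 1) ^ (-(p + 1))) +
        ∑ k ∈ Finset.Ico a (max a N), min ((n : ℝ)⁻¹) (((k : ℝ) + 1) ^ (-(p + 1))) :=
        (Finset.sum_range_add_sum_Ico _ (le_max_left _ _)).symm
    _ ≤ ∑ k ∈ Finset.range a, (n : ℝ)⁻¹ +
        ∑ k ∈ Finset.Ico a (max a N), ((k : ℝ) + 1) ^ (-(p + 1)) :=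
        add_le_add (Finset.sum_le_sum fun k _ => min_le_left _ _)
          (Finset.sum_le_sum fun k _ => min_le_right _ _)
    _ ≤ 2 * J * (n : ℝ)⁻¹ + J ^ (-p) / p := by
        refine add_le_add ?_ ((sum_Ico_rpow_le hp ha1 _).trans ?_)
        · rw [Finset.sum_const, Finset.card_range, nsmul_eq_mul]
          have : (a : ℝ) < J + 1 := Nat.ceil_lt_add_one (by positivity)
          gcongr
          linarith
        · gcongr ?_ / p
          exact Real.rpow_le_rpow_of_nonpos (by positivity) (Nat.le_ceil J) (by linarith)
    _ = (2 + 1 / p) * (n : ℝ) ^ (-p / (p + 1)) := by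
        rw [mul_assoc, hJn, hJp]; ring

/-! ### The sup-norm of a Gaussian series -/

/-- The `m`-th block of frequencies: `[0, n)` for `m = 0` and `[n ^ m, n ^ (m + 1))` otherwise. -/
def block (n m : ℕ) : Finset ℕ := if m = 0 then Finset.range n else Finset.Ico (n ^ m) (n ^ (m + 1))

theorem lt_of_mem_block {n m k : ℕ} (h : k ∈ block n m) : k < n ^ (m + 1) := by
  unfold block at h
  split_ifs at h with hm
  · simpa [hm] using h
  · exact (Finset.mem_Ico.1 h).2

theorem trunc_pow_succ {n : ℕ} (hn : 1 ≤ n) {m : ℕ} (hm : m ≠ 0) (θ : ℕ → ℝ) :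
    trunc (n ^ (m + 1)) θ = trunc (n ^ m) θ + restr (block n m) θ := by
  have hle : n ^ m ≤ n ^ (m + 1) := Nat.pow_le_pow_right hn (Nat.le_succ m)
  ext k
  simp only [trunc, restr, block, hm, if_false, Finset.mem_Ico, Pi.add_apply]
  by_cases h1 : k < n ^ m
  · simp [h1, h1.trans_le hle]
  · simp [h1, not_lt.1 h1]

theorem supN_trunc_pow_le {n : ℕ} (hn : 1 ≤ n) (θ : ℕ → ℝ) (m : ℕ) :
    supN (trunc (n ^ (m + 1)) θ) ≤ ∑ i ∈ Finset.range (m + 1), supN (restr (block n i) θ) := by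
  induction m with
  | zero => simp [block, restr_range]
  | succ m ih =>
    rw [trunc_pow_succ hn (Nat.succ_ne_zero m), Finset.sum_range_succ]
    refine (supN_add_le (sqSummable_of_finite _ trunc_eq_zero) (sqSummable_restr _ _)).trans ?_
    exact add_le_add_left ih _

theorem summable_block_weights {α : ℝ} (hα : 0 < α) :
    Summable fun m : ℕ => ((m : ℝ) + 1) * ((2 : ℝ) ^ (-α)) ^ m := by
  have h0 : 0 ≤ (2 : ℝ) ^ (-α) := by positivity
  have h1 : (2 : ℝ) ^ (-α) < 1 := Real.rpow_lt_one_of_one_lt_of_neg one_lt_two (by linarith)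
  have hs1 := summable_pow_mul_geometric_of_norm_lt_one 1
    (r := (2 : ℝ) ^ (-α)) (by rwa [Real.norm_of_nonneg h0])
  have hs2 := summable_geometric_of_lt_one h0 h1
  refine (hs1.add hs2).congr fun m => by ring

/-- The constant in the tail bound for the sup-norm. -/
def tailConst (α : ℝ) : ℝ :=
  12 * (√(6 * (2 + 1 / (2 * α))) * 2 ^ α) * ∑' m : ℕ, ((m : ℝ) + 1) * ((2 : ℝ) ^ (-α)) ^ m

theorem tailConst_nonneg (α : ℝ) : 0 ≤ tailConst α :=
  mul_nonneg (by positivity) (tsum_nonneg fun m => by positivity)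

/-- The weights `σ` are dominated by `min (n ^ (-1/2), i ^ (-α - 1/2))`. -/
def Dominated (α : ℝ) (n : ℕ) (σ : ℕ → ℝ) : Prop :=
  ∀ k, σ k ^ 2 ≤ min ((n : ℝ)⁻¹) (((k : ℝ) + 1) ^ (-(2 * α + 1)))

theorem summable_rpow_weights {α : ℝ} (hα : 0 < α) :
    Summable fun k : ℕ => ((k : ℝ) + 1) ^ (-(2 * α + 1)) := by
  have h := (summable_nat_add_iff 1).2 (Real.summable_nat_rpow.2
    (show -(2 * α + 1) < -1 by linarith))
  simpa using h

theorem Dominated.sqSummable {α : ℝ} (hα : 0 < α) {n : ℕ} {σ : ℕ → ℝ} (h : Dominated α n σ) :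
    SqSummable σ :=
  Summable.of_nonneg_of_le (fun _ => sq_nonneg _) (fun k => (h k).trans (min_le_right _ _))
    (summable_rpow_weights hα)

/-- The standard deviation on the `m`-th block. -/
def blockDev (α : ℝ) (n m : ℕ) : ℝ :=
  √(2 + 1 / (2 * α)) * (n : ℝ) ^ (-α / (2 * α + 1)) * 2 ^ α * ((2 : ℝ) ^ (-α)) ^ m

theorem Dominated.sum_block_le {α : ℝ} (hα : 0 < α) {n : ℕ} (hn : 2 ≤ n) {σ : ℕ → ℝ}
    (h : Dominated α n σ) (m : ℕ) : ∑ k ∈ block n m, σ k ^ 2 ≤ blockDev α n m ^ 2 := by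
  have hn0 : (0 : ℝ) < n := by positivity
  have hn2 : (2 : ℝ) ≤ n := by exact_mod_cast hn
  have hD : 0 ≤ 2 + 1 / (2 * α) := by positivity
  have hρ : ((n : ℝ) ^ (-α / (2 * α + 1))) ^ 2 = (n : ℝ) ^ (-(2 * α) / (2 * α + 1)) := by
    rw [← Real.rpow_natCast, ← Real.rpow_mul hn0.le]; congr 1; push_cast; ring
  have hq : ((2 : ℝ) ^ α * ((2 : ℝ) ^ (-α)) ^ m) ^ 2 = (2 : ℝ) ^ (-(2 * α) * (m - 1)) := by
    rw [← Real.rpow_natCast (((2 : ℝ) ^ (-α))), ← Real.rpow_mul zero_le_two,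
      ← Real.rpow_add zero_lt_two, ← Real.rpow_natCast, ← Real.rpow_mul zero_le_two]
    congr 1; push_cast; ring
  have hdev : blockDev α n m ^ 2 = (2 + 1 / (2 * α)) * (n : ℝ) ^ (-(2 * α) / (2 * α + 1)) *
      (2 : ℝ) ^ (-(2 * α) * (m - 1)) := by
    rw [blockDev, mul_assoc, mul_pow, hq, mul_pow, hρ, Real.sq_sqrt hD]
  rw [hdev]
  by_cases hm : m = 0
  · subst hm
    rw [block, if_pos rfl]
    refine (Finset.sum_le_sum fun k _ => h k).trans
      ((sum_min_rpow_le (by positivity) (by omega) n).trans ?_)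
    refine le_mul_of_one_le_right (by positivity) (Real.one_le_rpow one_le_two ?_)
    push_cast; linarith
  · have hm1 : (1 : ℝ) ≤ m := by exact_mod_cast Nat.one_le_iff_ne_zero.2 hm
    rw [block, if_neg hm]
    calc ∑ k ∈ Finset.Ico (n ^ m) (n ^ (m + 1)), σ k ^ 2
        ≤ ∑ k ∈ Finset.Ico (n ^ m) (n ^ (m + 1)), ((k : ℝ) + 1) ^ (-(2 * α + 1)) :=
          Finset.sum_le_sum fun k _ => (h k).trans (min_le_right _ _)
      _ ≤ ((n ^ m : ℕ) : ℝ) ^ (-(2 * α)) / (2 * α) :=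
          sum_Ico_rpow_le (by positivity) (Nat.one_le_pow _ _ (by omega)) _
      _ = 1 / (2 * α) * (n : ℝ) ^ (-(2 * α) / (2 * α + 1)) *
          (n : ℝ) ^ (-(2 * α) * (m - 1 / (2 * α + 1))) := by
          rw [mul_assoc, ← Real.rpow_add hn0]
          push_cast
          rw [← Real.rpow_natCast, ← Real.rpow_mul hn0.le, div_eq_mul_one_div, mul_comm]
          congr 2; ring
      _ ≤ (2 + 1 / (2 * α)) * (n : ℝ) ^ (-(2 * α) / (2 * α + 1)) *
          (2 : ℝ) ^ (-(2 * α) * (m - 1)) := by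
          have h1 : 1 / (2 * α + 1) ≤ 1 := by
            rw [div_le_one (by positivity)]; linarith
          have h2 : (n : ℝ) ^ (-(2 * α) * (m - 1 / (2 * α + 1))) ≤
              (2 : ℝ) ^ (-(2 * α) * (m - 1)) := by
            calc (n : ℝ) ^ (-(2 * α) * (m - 1 / (2 * α + 1)))
                ≤ (n : ℝ) ^ (-(2 * α) * (m - 1)) := by
                  refine Real.rpow_le_rpow_of_exponent_le (by linarith) ?_
                  nlinarith
              _ ≤ (2 : ℝ) ^ (-(2 * α) * (m - 1)) :=
                  Real.rpow_le_rpow_of_nonpos zero_lt_two hn2 (by nlinarith)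
          gcongr
          linarith

/-- The sup-norm of a Gaussian series exceeds the rate only with small probability. -/
theorem noise_supN_gt_le {α : ℝ} (hα : 0 < α) {n : ℕ} (hn : 2 ≤ n) {σ : ℕ → ℝ}
    (h : Dominated α n σ) {A : ℝ} (hA : 1 ≤ A) :
    noise {z | ENNReal.ofReal (tailConst α * √A * rate α n) < supN fun k => σ k * z k} ≤
      ENNReal.ofReal (12 * (n : ℝ) ^ (-A)) := by
  have hn0 : (0 : ℝ) < n := by positivity
  have hn2 : (2 : ℝ) ≤ n := by exact_mod_cast hn
  set l := Real.log n
  have hl0 : 0 < l := Real.log_pos (by linarith)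
  set w : ℕ → ℝ := fun m => √(6 * A * (m + 1) * l) with hw
  have hw0 : ∀ m, 0 ≤ w m := fun m => Real.sqrt_nonneg _
  have hdev : ∀ m, 0 < blockDev α n m := fun m => by unfold blockDev; positivity
  set q : ℝ := (n : ℝ) ^ (-A) with hq
  have hq0 : 0 < q := by positivity
  have hq2 : q ≤ 1 / 2 := by
    calc q ≤ (n : ℝ) ^ (-1 : ℝ) := Real.rpow_le_rpow_of_exponent_le (by linarith) (by linarith)
      _ = (n : ℝ)⁻¹ := Real.rpow_neg_one _
      _ ≤ 1 / 2 := by rw [one_div]; exact inv_anti₀ two_pos hn2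
  set bad : ℕ → Set (ℕ → ℝ) := fun m =>
    {z | ENNReal.ofReal (12 * √(blockDev α n m ^ 2) * w m) <
      supN (restr (block n m) fun k => σ k * z k)}
  have hbadle : ∀ m, noise (bad m) ≤ ENNReal.ofReal (6 * q ^ (m + 1)) := fun m => by
    refine (noise_supN_restr_gt_le (Nat.one_le_pow _ _ (by omega)) (fun k hk => lt_of_mem_block hk)
      (pow_pos (hdev m) 2) (h.sum_block_le hα hn m) (hw0 m)).trans (ENNReal.ofReal_le_ofReal ?_)
    rw [mul_assoc]
    refine mul_le_mul_of_nonneg_left ?_ (by norm_num)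
    have e1 : (((n ^ (m + 1) : ℕ) : ℝ)) ^ 2 = Real.exp (l * (2 * (m + 1))) := by
      rw [← Real.rpow_def_of_pos hn0]
      push_cast
      rw [← pow_mul, ← Real.rpow_natCast]; congr 1; push_cast; ring
    have e2 : q ^ (m + 1) = Real.exp (l * (-A * (m + 1))) := by
      rw [← Real.rpow_def_of_pos hn0, hq, ← Real.rpow_natCast, ← Real.rpow_mul hn0.le]
      push_cast; rfl
    rw [e1, e2, ← Real.exp_add, Real.exp_le_exp, hw, Real.sq_sqrt (by positivity)]
    have : 0 ≤ l * (m + 1) * (A - 1) := mul_nonneg (by positivity) (by linarith)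
    nlinarith
  have hae := ae_sqSummable_mul (h.sqSummable hα)
  have hsub : {z : ℕ → ℝ | ENNReal.ofReal (tailConst α * √A * rate α n) <
      supN fun k => σ k * z k} ≤ᵐ[noise] ⋃ m, bad m := by
    filter_upwards [hae] with z hz hz2
    by_contra hcon
    have hcon' : ∀ m, z ∉ bad m := fun m hm => hcon (Set.mem_iUnion.2 ⟨m, hm⟩)
    refine absurd hz2 (not_lt.2 ?_)
    refine supN_le_of_trunc hz (ns := fun m => n ^ (m + 1))
      ((tendsto_pow_atTop_atTop_of_one_lt (by omega)).comp (tendsto_add_atTop_nat 1))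
      fun m => ?_
    refine (supN_trunc_pow_le (by omega) _ m).trans ?_
    refine (Finset.sum_le_sum fun i _ => not_lt.1 (hcon' i)).trans ?_
    rw [← ENNReal.ofReal_sum_of_nonneg fun i _ => by positivity]
    refine ENNReal.ofReal_le_ofReal ?_
    have hterm : ∀ i : ℕ, 12 * √(blockDev α n i ^ 2) * w i ≤
        (12 * (√(6 * (2 + 1 / (2 * α))) * 2 ^ α) * √A * rate α n) *
          (((i : ℝ) + 1) * ((2 : ℝ) ^ (-α)) ^ i) := fun i => by
      have hwi : w i ≤ √6 * √A * (i + 1) * √l := by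
        rw [hw]
        simp only
        rw [Real.sqrt_mul (by positivity), Real.sqrt_mul (by positivity),
          Real.sqrt_mul (by positivity)]
        gcongr
        rw [Real.sqrt_le_left (by positivity)]
        have : (0 : ℝ) ≤ i := by positivity
        nlinarith
      rw [Real.sqrt_sq (hdev i).le]
      refine (mul_le_mul_of_nonneg_left hwi (by have := hdev i; positivity)).trans (le_of_eq ?_)
      rw [blockDev, rate, Real.sqrt_mul (by norm_num : (0 : ℝ) ≤ 6)]
      ring
    have hr : 0 ≤ rate α n := by unfold rate; positivity
    calc ∑ i ∈ Finset.range (m + 1), 12 * √(blockDev α n i ^ 2) * w i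
        ≤ ∑ i ∈ Finset.range (m + 1), (12 * (√(6 * (2 + 1 / (2 * α))) * 2 ^ α) * √A * rate α n) *
          (((i : ℝ) + 1) * ((2 : ℝ) ^ (-α)) ^ i) := Finset.sum_le_sum fun i _ => hterm i
      _ = (12 * (√(6 * (2 + 1 / (2 * α))) * 2 ^ α) * √A * rate α n) *
          ∑ i ∈ Finset.range (m + 1), (((i : ℝ) + 1) * ((2 : ℝ) ^ (-α)) ^ i) := by
          rw [Finset.mul_sum]
      _ ≤ (12 * (√(6 * (2 + 1 / (2 * α))) * 2 ^ α) * √A * rate α n) *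
          ∑' i : ℕ, (((i : ℝ) + 1) * ((2 : ℝ) ^ (-α)) ^ i) := by
          refine mul_le_mul_of_nonneg_left ?_ (by positivity)
          exact (summable_block_weights hα).sum_le_tsum _ fun i _ => by positivity
      _ = tailConst α * √A * rate α n := by rw [tailConst]; ring
  refine (measure_mono_ae hsub).trans ((measure_iUnion_le _).trans
    ((ENNReal.tsum_le_tsum hbadle).trans ?_))
  have hq1 : q < 1 := by linarith
  have hgeo := hasSum_geometric_of_lt_one hq0.le hq1
  have hgeo' : HasSum (fun m : ℕ => 6 * q ^ (m + 1)) (6 * q * (1 - q)⁻¹) := by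
    have e : (fun m : ℕ => 6 * q ^ (m + 1)) = fun m => 6 * q * q ^ m := funext fun m => by ring
    rw [e]
    exact hgeo.mul_left _
  rw [← ENNReal.ofReal_tsum_of_nonneg (fun m => by positivity) hgeo'.summable, hgeo'.tsum_eq]
  refine ENNReal.ofReal_le_ofReal ?_
  have : (1 - q)⁻¹ ≤ 2 := by
    rw [inv_le_comm₀ (by linarith) two_pos]; linarith
  nlinarith

/-! ### The law of the sup-norm of a Gaussian series -/

theorem measurable_supN_mul (σ : ℕ → ℝ) : Measurable fun z : ℕ → ℝ => supN fun k => σ k * z k :=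
  measurable_supN.comp (measurable_pi_lambda _ fun k =>
    (measurable_const_mul (σ k)).comp (measurable_pi_apply k))

theorem tendsto_rate {α : ℝ} (hα : 0 < α) : Tendsto (rate α) atTop (𝓝 0) := by
  have h1 : Tendsto (fun x : ℝ => Real.log x / x ^ (2 * (α / (2 * α + 1)))) atTop (𝓝 0) :=
    (isLittleO_log_rpow_atTop (by positivity)).tendsto_div_nhds_zero
  have h2 := (Real.continuous_sqrt.tendsto 0).comp (h1.comp tendsto_natCast_atTop_atTop)
  rw [Real.sqrt_zero] at h2
  refine h2.congr fun n => ?_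
  have hn : (0 : ℝ) ≤ n := Nat.cast_nonneg n
  simp only [Function.comp_apply]
  rw [Real.sqrt_div' _ (by positivity), mul_comm (2 : ℝ), Real.rpow_mul hn, Real.rpow_two,
    Real.sqrt_sq (by positivity), rate, neg_div, Real.rpow_neg hn]
  field_simp

/-- Splitting the noise into the coordinates in a set and the others. -/
theorem noise_map_split (S : Set ℕ) [DecidablePred (· ∈ S)] :
    (noise.prod noise).map (fun (p : (ℕ → ℝ) × (ℕ → ℝ)) k => if k ∈ S then p.1 k else p.2 k) =
      noise := by
  have h := noise_prod_map_add (a := fun k => if k ∈ S then 1 else 0)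
    (b := fun k => if k ∈ S then 0 else 1) fun k => by split_ifs <;> norm_num
  convert h using 3 with p
  ext k
  split_ifs <;> simp

theorem measurable_split (S : Set ℕ) [DecidablePred (· ∈ S)] :
    Measurable fun (p : (ℕ → ℝ) × (ℕ → ℝ)) (k : ℕ) => if k ∈ S then p.1 k else p.2 k := by
  refine measurable_pi_lambda _ fun k => ?_
  split_ifs <;> fun_prop

theorem noise_abs_lt_pos (N : ℕ) {η : ℝ} (hη : 0 < η) :
    0 < noise {z | ∀ k < N, |z k| < η} := by
  have h : {z : ℕ → ℝ | ∀ k < N, |z k| < η} =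
      Set.pi (Finset.range N : Set ℕ) fun _ => Set.Ioo (-η) η := by
    ext z; simp [Set.mem_pi, abs_lt]
  rw [h, noise, Measure.infinitePi_pi _ fun _ _ => measurableSet_Ioo]
  rw [pos_iff_ne_zero, Finset.prod_ne_zero_iff]
  intro k _ h0
  have := gaussianReal_absolutelyContinuous' 0 one_ne_zero h0
  rw [Real.volume_Ioo, ENNReal.ofReal_eq_zero] at this
  linarith

/-- Small balls have positive probability. -/
theorem noise_supN_le_pos {α : ℝ} (hα : 0 < α) {σ : ℕ → ℝ}
    (h : ∀ k, σ k ^ 2 ≤ ((k : ℝ) + 1) ^ (-(2 * α + 1))) {δ : ℝ} (hδ : 0 < δ) :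
    0 < noise {z | supN (fun k => σ k * z k) ≤ ENNReal.ofReal δ ∧
      SqSummable fun k => σ k * z k} := by
  have hev : ∀ᶠ N : ℕ in atTop, tailConst α * √1 * rate α N < δ / 2 := by
    have := (tendsto_rate hα).const_mul (tailConst α * √1)
    rw [mul_zero] at this
    exact this.eventually (gt_mem_nhds (by positivity))
  obtain ⟨N, hN, hN13⟩ := (hev.and (eventually_ge_atTop 13)).exists
  set τ : ℕ → ℝ := fun k => if k < N then 0 else σ k with hτ
  have hτdom : Dominated α N τ := fun k => by
    simp only [hτ]
    split_ifs with hk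
    · rw [zero_pow two_ne_zero]; exact le_min (by positivity) (by positivity)
    · refine le_min ((h k).trans ?_) (h k)
      have hNk : (N : ℝ) ≤ (k : ℝ) + 1 := by
        have : (N : ℝ) ≤ k := by exact_mod_cast not_lt.1 hk
        linarith
      have hk1 : (1 : ℝ) ≤ (k : ℝ) + 1 := by linarith [(Nat.cast_nonneg k : (0 : ℝ) ≤ k)]
      calc ((k : ℝ) + 1) ^ (-(2 * α + 1)) ≤ ((k : ℝ) + 1) ^ (-1 : ℝ) :=
            Real.rpow_le_rpow_of_exponent_le hk1 (by linarith)
        _ = ((k : ℝ) + 1)⁻¹ := Real.rpow_neg_one _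
        _ ≤ (N : ℝ)⁻¹ := inv_anti₀ (by positivity) hNk
  have hT : 0 < noise {z | supN (fun k => τ k * z k) ≤ ENNReal.ofReal (δ / 2) ∧
      SqSummable fun k => τ k * z k} := by
    have h1 := noise_supN_gt_le hα (by omega) hτdom le_rfl
    rw [pos_iff_ne_zero]
    intro h0
    have hae := ae_sqSummable_mul (hτdom.sqSummable hα)
    have h2 : ∀ᵐ z ∂noise, z ∈ {z : ℕ → ℝ | ENNReal.ofReal (tailConst α * √1 * rate α N) <
        supN fun k => τ k * z k} := by
      filter_upwards [hae, measure_eq_zero_iff_ae_notMem.1 h0] with z hz hz'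
      by_contra hcon
      exact hz' ⟨(not_lt.1 hcon).trans (ENNReal.ofReal_le_ofReal hN.le), hz⟩
    rw [(prob_compl_eq_zero_iff₀ (MeasurableSet.nullMeasurableSet
      (measurableSet_lt measurable_const (measurable_supN_mul τ)))).1 h2, Real.rpow_neg_one] at h1
    have hN13' : (13 : ℝ) ≤ N := by exact_mod_cast hN13
    have : ENNReal.ofReal (12 * (N : ℝ)⁻¹) < 1 := by
      rw [ENNReal.ofReal_lt_one, mul_inv_lt_iff₀ (by positivity)]; linarith
    exact absurd h1 (not_le.2 this)
  set s : ℝ := √2 * ∑ k ∈ Finset.range N, |σ k| with hs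
  set η : ℝ := δ / 2 / (s + 1) with hη
  have hH := noise_abs_lt_pos N (η := η) (by positivity)
  have hprod := ENNReal.mul_pos hH.ne' hT.ne'
  rw [← Measure.prod_prod] at hprod
  refine hprod.trans_le ?_
  conv_rhs => rw [← noise_map_split (Set.Iio N)]
  refine le_trans (measure_mono ?_) (Measure.le_map_apply (measurable_split _).aemeasurable _)
  rintro ⟨u, z⟩ ⟨hu, hz1, hz2⟩
  have hdecomp : (fun k => σ k * if k ∈ Set.Iio N then u k else z k) =
      trunc N (fun k => σ k * u k) + fun k => τ k * z k := by
    ext k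
    simp only [trunc, hτ, Pi.add_apply, Set.mem_Iio]
    split_ifs <;> simp
  have hhead : supN (trunc N fun k => σ k * u k) ≤ ENNReal.ofReal (δ / 2) := by
    refine supN_of_finite_le (Finset.range N) trunc_eq_zero (by positivity) fun x _ => ?_
    calc |∑ k ∈ Finset.range N, trunc N (fun k => σ k * u k) k * fourierFun k x|
        ≤ ∑ k ∈ Finset.range N, |trunc N (fun k => σ k * u k) k * fourierFun k x| :=
          Finset.abs_sum_le_sum_abs _ _
      _ ≤ ∑ k ∈ Finset.range N, |σ k| * η * √2 := by
          refine Finset.sum_le_sum fun k hk => ?_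
          have hk' := Finset.mem_range.1 hk
          rw [trunc, if_pos hk', abs_mul, abs_mul]
          have := (hu k hk').le
          have := abs_fourierFun_le k x
          gcongr
      _ = s * η := by rw [← Finset.sum_mul, ← Finset.sum_mul, hs]; ring
      _ ≤ δ / 2 := by
          rw [hη, mul_div_assoc', div_le_iff₀ (by positivity)]; nlinarith
  have hsq := sqSummable_of_finite (Finset.range N) (trunc_eq_zero (θ := fun k => σ k * u k))
  change supN (fun k => σ k * if k ∈ Set.Iio N then u k else z k) ≤ _ ∧
    SqSummable (fun k => σ k * if k ∈ Set.Iio N then u k else z k)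
  rw [hdecomp]
  refine ⟨(supN_add_le hsq hz2).trans ((add_le_add hhead hz1).trans ?_), hsq.add hz2⟩
  rw [← ENNReal.ofReal_add (by positivity) (by positivity), add_halves]

theorem split_zero_eq (σ u z : ℕ → ℝ) :
    (fun k => σ k * if k ∈ ({0} : Set ℕ) then u k else z k) =
      constSeq (σ 0 * u 0) + fun k => (if k = 0 then 0 else σ k) * z k := by
  ext k
  simp only [constSeq, Pi.add_apply, Set.mem_singleton_iff]
  split_ifs with hk
  · simp [hk]
  · simp

theorem finite_setOf_supN_shift_eq {θ : ℕ → ℝ} (h : SqSummable θ) {r : ℝ} (hr : 0 ≤ r) :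
    {t : ℝ | supN (constSeq t + θ) = ENNReal.ofReal r}.Finite := by
  by_contra hinf
  obtain ⟨s, hs, hcard⟩ := Set.Infinite.exists_subset_card_eq hinf 3
  set t := s.orderEmbOfFin hcard
  have hmem : ∀ i, supN (constSeq (t i) + θ) = ENNReal.ofReal r := fun i =>
    hs (s.orderEmbOfFin_mem hcard i)
  have h01 : t 0 < t 1 := t.strictMono (by decide)
  have h12 : t 1 < t 2 := t.strictMono (by decide)
  exact (not_three_shifts h hr h01 h12 (hmem 0).le (hmem 2).le).ne (hmem 1)

/-- The law of the sup-norm has no atoms. -/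
theorem noise_supN_eq_zero {σ : ℕ → ℝ} (h : SqSummable σ) (h0 : σ 0 ≠ 0) {r : ℝ} (hr : 0 ≤ r) :
    noise {z | supN (fun k => σ k * z k) = ENNReal.ofReal r} = 0 := by
  have hm : MeasurableSet {z : ℕ → ℝ | supN (fun k => σ k * z k) = ENNReal.ofReal r} :=
    measurable_supN_mul σ (measurableSet_singleton _)
  rw [← noise_map_split {0}ᶜ, Measure.map_apply (measurable_split _) hm,
    Measure.measure_prod_null (measurable_split _ hm)]
  have hτ : SqSummable fun k => if k = 0 then 0 else σ k :=
    h.mono fun k => by split_ifs <;> simp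
  filter_upwards [ae_sqSummable_mul hτ] with z hz
  have hfin := (finite_setOf_supN_shift_eq hz hr).preimage
    (mul_right_injective₀ h0).injOn (f := fun x => σ 0 * x)
  have : NullSingletonClass (gaussianReal 0 1) := nullSingletonClass_gaussianReal one_ne_zero
  have hnull := hfin.measure_zero (gaussianReal 0 1)
  rw [← noise_map_eval 0] at hnull
  refine measure_mono_null (fun u hu => ?_) (le_antisymm
    ((Measure.le_map_apply (measurable_pi_apply 0).aemeasurable _).trans hnull.le) zero_le)
  have hu' : supN (fun k => σ k * if k ∈ ({0}ᶜ : Set ℕ) then z k else u k) =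
    ENNReal.ofReal r := hu
  have heq : (fun k => σ k * if k ∈ ({0}ᶜ : Set ℕ) then z k else u k) =
      constSeq (σ 0 * u 0) + fun k => (if k = 0 then 0 else σ k) * z k := by
    rw [← split_zero_eq σ u z]
    ext k
    simp only [Set.mem_compl_iff, Set.mem_singleton_iff]
    split_ifs <;> simp_all
  rw [heq] at hu'
  exact hu'

theorem noise_supN_mem_Ioo_pos {α : ℝ} (hα : 0 < α) {σ : ℕ → ℝ}
    (h : ∀ k, σ k ^ 2 ≤ ((k : ℝ) + 1) ^ (-(2 * α + 1))) (h0 : σ 0 ≠ 0) {a b : ℝ} (ha : 0 ≤ a)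
    (hab : a < b) :
    0 < noise {z | ENNReal.ofReal a < supN (fun k => σ k * z k) ∧
      supN (fun k => σ k * z k) < ENNReal.ofReal b} := by
  set δ := (b - a) / 4 with hδ
  have hδ0 : 0 < δ := by rw [hδ]; linarith
  have hU : 0 < noise {u | σ 0 * u 0 ∈ Set.Ioo (a + δ) (b - δ)} := by
    have hm : MeasurableSet {x : ℝ | σ 0 * x ∈ Set.Ioo (a + δ) (b - δ)} :=
      (measurable_const_mul (σ 0)) measurableSet_Ioo
    have : noise {u | σ 0 * u 0 ∈ Set.Ioo (a + δ) (b - δ)} =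
        gaussianReal 0 1 {x : ℝ | σ 0 * x ∈ Set.Ioo (a + δ) (b - δ)} := by
      rw [← noise_map_eval 0, Measure.map_apply (measurable_pi_apply 0) hm]; rfl
    rw [this, pos_iff_ne_zero]
    intro hz
    have hvol := gaussianReal_absolutelyContinuous' 0 one_ne_zero hz
    have hopen : IsOpen {x : ℝ | σ 0 * x ∈ Set.Ioo (a + δ) (b - δ)} :=
      isOpen_Ioo.preimage (continuous_const.mul continuous_id)
    have hne : {x : ℝ | σ 0 * x ∈ Set.Ioo (a + δ) (b - δ)}.Nonempty := by
      refine ⟨(a + 2 * δ) / σ 0, ?_⟩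
      rw [Set.mem_ofPred_eq, mul_div_cancel₀ _ h0]
      constructor <;> linarith
    exact (hopen.measure_pos volume hne).ne' hvol
  have hT := noise_supN_le_pos hα (σ := fun k => if k = 0 then 0 else σ k) (fun k => by
    split_ifs
    · rw [zero_pow two_ne_zero]; positivity
    · exact h k) hδ0
  have hprod := ENNReal.mul_pos hU.ne' hT.ne'
  rw [← Measure.prod_prod] at hprod
  refine hprod.trans_le ?_
  conv_rhs => rw [← noise_map_split {0}]
  refine le_trans (measure_mono ?_) (Measure.le_map_apply (measurable_split _).aemeasurable _)
  rintro ⟨u, z⟩ ⟨⟨hu1, hu2⟩, hz1, hz2⟩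
  change ENNReal.ofReal a < supN (fun k => σ k * if k ∈ ({0} : Set ℕ) then u k else z k) ∧
    supN (fun k => σ k * if k ∈ ({0} : Set ℕ) then u k else z k) < ENNReal.ofReal b
  rw [split_zero_eq]
  have habs : |σ 0 * u 0| = σ 0 * u 0 := abs_of_nonneg (by linarith)
  constructor
  · have h1 := (ofReal_abs_le_supN_add hz2 (t := σ 0 * u 0)).trans (add_le_add_right hz1 _)
    rw [habs] at h1
    by_contra hcon
    have h2 := h1.trans (add_le_add_left (not_lt.1 hcon) _)
    rw [← ENNReal.ofReal_add ha hδ0.le, ENNReal.ofReal_le_ofReal_iff (by linarith)] at h2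
    linarith
  · refine (supN_add_le (sqSummable_constSeq _) hz2).trans_lt ?_
    rw [supN_constSeq, habs]
    refine (add_le_add_right hz1 _).trans_lt ?_
    rw [← ENNReal.ofReal_add (by linarith) hδ0.le]
    exact (ENNReal.ofReal_lt_ofReal_iff (by linarith)).2 (by linarith)

theorem ae_supN_lt_top {α : ℝ} (hα : 0 < α) {n : ℕ} (hn : 2 ≤ n) {σ : ℕ → ℝ}
    (h : Dominated α n σ) : ∀ᵐ z ∂noise, supN (fun k => σ k * z k) < ∞ := by
  have hle : ∀ A : ℕ, 1 ≤ A → noise {z | ¬ supN (fun k => σ k * z k) < ∞} ≤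
      ENNReal.ofReal (12 * (n : ℝ) ^ (-(A : ℝ))) := fun A hA => by
    refine (measure_mono fun z hz => ?_).trans (noise_supN_gt_le hα hn h (by exact_mod_cast hA))
    rw [Set.mem_ofPred_eq, not_lt, top_le_iff] at hz
    rw [Set.mem_ofPred_eq, hz]
    exact ENNReal.ofReal_lt_top
  have hlim : Tendsto (fun A : ℕ => ENNReal.ofReal (12 * (n : ℝ) ^ (-(A : ℝ)))) atTop (𝓝 0) := by
    have h1 : Tendsto (fun A : ℕ => 12 * ((n : ℝ)⁻¹) ^ A) atTop (𝓝 0) := by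
      have := (tendsto_pow_atTop_nhds_zero_of_lt_one (r := (n : ℝ)⁻¹) (by positivity)
        (inv_lt_one_of_one_lt₀ (by exact_mod_cast hn))).const_mul 12
      rwa [mul_zero] at this
    have h2 := ENNReal.tendsto_ofReal h1
    rw [ENNReal.ofReal_zero] at h2
    refine h2.congr fun A => ?_
    rw [Real.rpow_neg (by positivity), Real.rpow_natCast, inv_pow]
  exact le_antisymm (ge_of_tendsto hlim ((eventually_ge_atTop 1).mono hle)) zero_le

/-- The sup-norm has a unique quantile of each order. -/
theorem exists_quantile {α : ℝ} (hα : 0 < α) {n : ℕ} (hn : 2 ≤ n) {σ : ℕ → ℝ}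
    (h : Dominated α n σ) (h0 : σ 0 ≠ 0) {c : ℝ} (hc0 : 0 < c) (hc1 : c < 1) :
    ∃ q : ℝ, 0 < q ∧ ∀ r : ℝ,
      noise {z | supN (fun k => σ k * z k) ≤ ENNReal.ofReal r} = ENNReal.ofReal c ↔ r = q := by
  set X : (ℕ → ℝ) → ℝ := fun z => (supN fun k => σ k * z k).toReal with hX
  have hXm : Measurable X := (measurable_supN_mul σ).ennreal_toReal
  set μ : Measure ℝ := noise.map X with hμ
  have : IsProbabilityMeasure μ := Measure.isProbabilityMeasure_map hXm.aemeasurable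
  have hfin := ae_supN_lt_top hα hn h
  have hatom : ∀ r, μ {r} = 0 := fun r => by
    rw [hμ, Measure.map_apply hXm (measurableSet_singleton r)]
    rcases lt_or_ge r 0 with hr | hr
    · have : X ⁻¹' {r} = ∅ := by
        ext z
        simp only [Set.mem_preimage, Set.mem_singleton_iff, Set.mem_empty_iff_false, iff_false]
        exact (hr.trans_le ENNReal.toReal_nonneg).ne'
      rw [this, measure_empty]
    · rw [measure_eq_zero_iff_ae_notMem]
      filter_upwards [hfin, measure_eq_zero_iff_ae_notMem.1
        (noise_supN_eq_zero (h.sqSummable hα) h0 hr)] with z hz hz' hzr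
      exact hz' (by rw [← show X z = r from hzr, hX, ENNReal.ofReal_toReal hz.ne])
  have hF : ∀ r, 0 ≤ r → noise {z | supN (fun k => σ k * z k) ≤ ENNReal.ofReal r} =
      ENNReal.ofReal (cdf μ r) := fun r hr => by
    rw [ofReal_cdf, hμ, Measure.map_apply hXm measurableSet_Iic]
    refine measure_congr ?_
    filter_upwards [hfin] with z hz
    exact propext (ENNReal.le_ofReal_iff_toReal_le hz.ne hr)
  have hcont : Continuous (cdf μ) := by
    rw [continuous_iff_continuousAt]
    intro x
    rw [(monotone_cdf μ).continuousAt_iff_leftLim_eq_rightLim, StieltjesFunction.rightLim_eq]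
    have h1 := StieltjesFunction.measure_singleton (cdf μ) x
    rw [measure_cdf, hatom, eq_comm, ENNReal.ofReal_eq_zero] at h1
    exact le_antisymm ((monotone_cdf μ).leftLim_le le_rfl) (by linarith)
  have hzero : cdf μ 0 = 0 := by
    have h1 : μ (Set.Iic 0) = 0 := by
      rw [← Set.Iio_union_right]
      refine measure_union_null ?_ (hatom 0)
      rw [hμ, Measure.map_apply hXm measurableSet_Iio]
      have : X ⁻¹' Set.Iio 0 = ∅ := by
        ext z
        simp only [Set.mem_preimage, Set.mem_Iio, Set.mem_empty_iff_false, iff_false, not_lt]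
        exact ENNReal.toReal_nonneg
      rw [this, measure_empty]
    rw [← ofReal_cdf, ENNReal.ofReal_eq_zero] at h1
    exact le_antisymm h1 (cdf_nonneg μ 0)
  obtain ⟨b, hb⟩ := ((tendsto_cdf_atTop μ).eventually (lt_mem_nhds hc1)).exists
  obtain ⟨q, hq⟩ := mem_range_of_exists_le_of_exists_ge hcont ⟨0, hzero.le.trans hc0.le⟩ ⟨b, hb.le⟩
  have hq0 : 0 < q := by
    by_contra hcon
    have := monotone_cdf μ (not_lt.1 hcon)
    rw [hzero, hq] at this
    linarith
  have hstrict : ∀ r s, 0 ≤ r → r < s → cdf μ r < cdf μ s := fun r s hr hrs => by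
    have hpos := noise_supN_mem_Ioo_pos hα (fun k => (h k).trans (min_le_right _ _)) h0 hr hrs
    rw [← ENNReal.ofReal_lt_ofReal_iff_of_nonneg (cdf_nonneg μ r), ← hF r hr,
      ← hF s (hr.trans hrs.le)]
    refine lt_of_lt_of_le ?_ (measure_mono (s := {z | supN (fun k => σ k * z k) ≤
      ENNReal.ofReal r} ∪ {z | ENNReal.ofReal r < supN (fun k => σ k * z k) ∧
      supN (fun k => σ k * z k) < ENNReal.ofReal s}) ?_)
    · rw [measure_union]
      · exact ENNReal.lt_add_right (measure_ne_top _ _) hpos.ne'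
      · rw [Set.disjoint_left]
        intro z hz hz'
        exact absurd hz'.1 (not_lt.2 hz)
      · exact (measurableSet_lt measurable_const (measurable_supN_mul σ)).inter
          (measurableSet_lt (measurable_supN_mul σ) measurable_const)
    · rintro z (hz | hz)
      · exact le_trans (α := ℝ≥0∞) hz (ENNReal.ofReal_le_ofReal hrs.le)
      · exact hz.2.le
  refine ⟨q, hq0, fun r => ⟨fun hr => ?_, fun hr => ?_⟩⟩
  · rcases lt_or_ge r 0 with hr0 | hr0
    · rw [ENNReal.ofReal_of_nonpos hr0.le, ← ENNReal.ofReal_zero, hF 0 le_rfl, hzero,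
        ENNReal.ofReal_zero, eq_comm, ENNReal.ofReal_eq_zero] at hr
      linarith
    · rw [hF r hr0, ENNReal.ofReal_eq_ofReal_iff (cdf_nonneg μ r) hc0.le, ← hq] at hr
      rcases lt_trichotomy r q with hlt | heq | hgt
      · exact absurd hr (hstrict r q hr0 hlt).ne
      · exact heq
      · exact absurd hr (hstrict q r hq0.le hgt).ne'
  · rw [hr, hF q hq0.le, hq]

/-! ### A lower bound for the sup-norm of a Gaussian series -/

theorem sum_fourierFun_mul (m : ℕ) (x y : ℝ) :
    ∑ k ∈ Finset.range (2 * m + 1), fourierFun k x * fourierFun k y =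
      1 + 2 * ∑ l ∈ Finset.range m, Real.cos (2 * Real.pi * (l + 1) * (x - y)) := by
  induction m with
  | zero => simp [fourierFun]
  | succ m ih =>
    have h2 : √2 * √2 = (2 : ℝ) := Real.mul_self_sqrt (by norm_num)
    have hodd : ∀ u, fourierFun (2 * m + 1) u = √2 * Real.cos (2 * Real.pi * (m + 1) * u) := by
      intro u
      have h3 : (2 * m + 1 + 1) / 2 = m + 1 := by omega
      rw [fourierFun, if_neg (by omega), if_pos ⟨m, rfl⟩, h3]
      push_cast; rfl
    have heven : ∀ u, fourierFun (2 * m + 2) u = √2 * Real.sin (2 * Real.pi * (m + 1) * u) := by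
      intro u
      have h3 : (2 * m + 2) / 2 = m + 1 := by omega
      have h4 : ¬ Odd (2 * m + 2) := Nat.not_odd_iff_even.2 ⟨m + 1, by ring⟩
      rw [fourierFun, if_neg (by omega), if_neg h4, h3]
      push_cast; rfl
    rw [show 2 * (m + 1) + 1 = 2 * m + 1 + 1 + 1 by ring, Finset.sum_range_succ,
      Finset.sum_range_succ, ih, Finset.sum_range_succ, hodd, hodd,
      show 2 * m + 1 + 1 = 2 * m + 2 by ring, heven, heven, mul_sub (2 * Real.pi * ((m : ℝ) + 1)),
      Real.cos_sub]
    linear_combination (Real.cos (2 * Real.pi * (m + 1) * x) * Real.cos (2 * Real.pi * (m + 1) * y) +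
      Real.sin (2 * Real.pi * (m + 1) * x) * Real.sin (2 * Real.pi * (m + 1) * y)) * h2

theorem sin_mul_dirichlet (m : ℕ) (t : ℝ) :
    Real.sin (Real.pi * t) *
        (1 + 2 * ∑ l ∈ Finset.range m, Real.cos (2 * Real.pi * (l + 1) * t)) =
      Real.sin ((2 * m + 1) * (Real.pi * t)) := by
  induction m with
  | zero => simp
  | succ m ih =>
    rw [Finset.sum_range_succ, mul_add 2, ← add_assoc, mul_add, ih]
    push_cast
    rw [show (2 * (m : ℝ) + 1) * (Real.pi * t) = 2 * Real.pi * (m + 1) * t - Real.pi * t by ring,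
      show (2 * ((m : ℝ) + 1) + 1) * (Real.pi * t) = 2 * Real.pi * (m + 1) * t + Real.pi * t by ring,
      Real.sin_add, Real.sin_sub]
    ring

/-- Discrete orthogonality on an equidistant grid of odd size. -/
theorem sum_fourierFun_grid (m : ℕ) (t : ℝ) (i j : Fin (2 * m + 1)) :
    ∑ k ∈ Finset.range (2 * m + 1),
      fourierFun k (i / (2 * m + 1 : ℕ) + t) * fourierFun k (j / (2 * m + 1 : ℕ) + t) =
      if i = j then ((2 * m + 1 : ℕ) : ℝ) else 0 := by
  have hN0 : (0 : ℝ) < ((2 * m + 1 : ℕ) : ℝ) := by positivity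
  rw [sum_fourierFun_mul]
  split_ifs with hij
  · subst hij
    simp; ring
  · set u : ℝ := (i : ℝ) / (2 * m + 1 : ℕ) + t - (j / (2 * m + 1 : ℕ) + t) with hu
    have hNu : ((2 * m + 1 : ℕ) : ℝ) * u = ((i : ℤ) - (j : ℤ) : ℤ) := by
      rw [hu, add_sub_add_right_eq_sub, ← sub_div, mul_div_cancel₀ _ hN0.ne']; push_cast; rfl
    have h := sin_mul_dirichlet m u
    have hsin : Real.sin ((2 * m + 1) * (Real.pi * u)) = 0 := by
      rw [show (2 * (m : ℝ) + 1) * (Real.pi * u) = (((2 * m + 1 : ℕ) : ℝ) * u) * Real.pi by push_cast; ring,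
        hNu, Real.sin_int_mul_pi]
    rw [hsin] at h
    refine (mul_eq_zero.1 h).resolve_left fun h0 => ?_
    obtain ⟨d, hd⟩ := Real.sin_eq_zero_iff.1 h0
    have hdu : (d : ℝ) = u := by
      have := Real.pi_pos
      rw [mul_comm] at hd
      exact mul_left_cancel₀ this.ne' hd
    rw [← hdu] at hNu
    have heqn : ((2 * m + 1 : ℕ) : ℤ) * d = (i : ℤ) - j := by exact_mod_cast hNu
    have hne : (i : ℕ) ≠ j := fun h => hij (Fin.ext h)
    rcases lt_trichotomy d 0 with hd0 | hd0 | hd0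
    · have : ((2 * m + 1 : ℕ) : ℤ) * d ≤ -((2 * m + 1 : ℕ) : ℤ) := by nlinarith
      omega
    · rw [hd0, mul_zero] at heqn; omega
    · have : ((2 * m + 1 : ℕ) : ℤ) ≤ ((2 * m + 1 : ℕ) : ℤ) * d := by nlinarith
      omega

/-- The values on the shifted grid of a random trigonometric polynomial with equal variances are
independent. -/
theorem noise_map_grid (m : ℕ) (t : ℝ) :
    noise.map (fun (z : ℕ → ℝ) (j : Fin (2 * m + 1)) => (√((2 * m + 1 : ℕ) : ℝ))⁻¹ *
      ∑ k ∈ Finset.range (2 * m + 1), fourierFun k (j / (2 * m + 1 : ℕ) + t) * z k) =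
      Measure.pi fun _ => gaussianReal 0 1 := by
  set N : ℕ := 2 * m + 1
  have hN0 : (0 : ℝ) < (N : ℝ) := by positivity
  set c : ℝ := (√(N : ℝ))⁻¹ with hc
  have hcN : c ^ 2 * N = 1 := by
    rw [hc, inv_pow, Real.sq_sqrt hN0.le, inv_mul_cancel₀ hN0.ne']
  set F : ℕ → Fin N → ℝ := fun k j => fourierFun k (j / (N : ℕ) + t)
  set T : (Finset.range N → ℝ) →L[ℝ] (Fin N → ℝ) :=
    ContinuousLinearMap.pi fun j => c • ∑ k : Finset.range N, F k j •
      ContinuousLinearMap.proj (R := ℝ) (φ := fun _ : Finset.range N => ℝ) k with hT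
  have hTapp : ∀ v j, T v j = c * ∑ k : Finset.range N, F k j * v k := fun v j => by
    simp [hT]
  have hcomp : (fun (z : ℕ → ℝ) (j : Fin N) => c *
      ∑ k ∈ Finset.range N, fourierFun k (j / (N : ℕ) + t) * z k) =
      T ∘ (Finset.range N).restrict := by
    ext z j
    rw [Function.comp_apply, hTapp]
    congr 1
    exact (Finset.sum_coe_sort (Finset.range N) fun k => F k j * z k).symm
  rw [hcomp, ← Measure.map_map T.continuous.measurable (by fun_prop), noise,
    Measure.infinitePi_map_restrict]
  refine Measure.ext_of_charFunDual (funext fun L => ?_)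
  rw [charFunDual_map, charFunDual_pi, charFunDual_pi]
  simp only [charFunDual_gaussianReal_zero_one, ← Complex.exp_sum]
  congr 1
  set ℓ : Fin N → ℝ := fun j => L (Pi.single j 1)
  have hL : ∀ v : Fin N → ℝ, L v = ∑ j, v j * ℓ j := fun v => by
    conv_lhs => rw [← Finset.univ_sum_single v]
    rw [map_sum]
    refine Finset.sum_congr rfl fun j _ => ?_
    have : Pi.single j (v j) = v j • (Pi.single j (1 : ℝ) : Fin N → ℝ) := by
      rw [← Pi.single_smul, smul_eq_mul, mul_one]
    rw [this, map_smul, smul_eq_mul]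
  have hLT : ∀ k : Finset.range N, L (T (Pi.single k 1)) = c * ∑ j, F k j * ℓ j := fun k => by
    rw [hL, Finset.mul_sum]
    refine Finset.sum_congr rfl fun j _ => ?_
    rw [hTapp]
    simp [Pi.single_apply, mul_assoc]
  have hreal : ∑ k : Finset.range N, (L (T (Pi.single k 1))) ^ 2 = ∑ j, ℓ j ^ 2 := by
    simp_rw [hLT]
    rw [Finset.sum_coe_sort (Finset.range N) fun k => (c * ∑ j, F k j * ℓ j) ^ 2]
    have h1 : ∀ k, (c * ∑ j, F k j * ℓ j) ^ 2 =
        ∑ i, ∑ j, c ^ 2 * (ℓ i * ℓ j) * (F k i * F k j) := fun k => by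
      rw [mul_pow, sq (∑ j, F k j * ℓ j), Finset.sum_mul_sum, Finset.mul_sum]
      refine Finset.sum_congr rfl fun i _ => ?_
      rw [Finset.mul_sum]
      exact Finset.sum_congr rfl fun j _ => by ring
    simp_rw [h1]
    rw [Finset.sum_comm]
    refine Finset.sum_congr rfl fun i _ => ?_
    rw [Finset.sum_comm]
    simp_rw [← Finset.mul_sum]
    have h2 : ∀ j, ∑ k ∈ Finset.range N, F k i * F k j = if i = j then (N : ℝ) else 0 :=
      fun j => sum_fourierFun_grid m t i j
    simp_rw [h2]
    simp only [mul_ite, mul_zero, Finset.sum_ite_eq, Finset.mem_univ, if_true]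
    linear_combination ℓ i ^ 2 * hcN
  simp only [ContinuousLinearMap.comp_apply, ContinuousLinearMap.single_apply]
  rw [← Finset.sum_div, ← Finset.sum_div, Finset.sum_neg_distrib, Finset.sum_neg_distrib]
  congr 2
  exact_mod_cast hreal

theorem gaussianReal_Ioi_ge {u : ℝ} (hu : 0 ≤ u) :
    ENNReal.ofReal ((√(2 * Real.pi))⁻¹ * Real.exp (-1) * Real.exp (-u ^ 2)) ≤
      gaussianReal 0 1 (Set.Ioi u) := by
  rw [gaussianReal_apply _ one_ne_zero]
  calc ENNReal.ofReal ((√(2 * Real.pi))⁻¹ * Real.exp (-1) * Real.exp (-u ^ 2))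
      = ∫⁻ _ in Set.Ioc u (u + 1),
          ENNReal.ofReal ((√(2 * Real.pi))⁻¹ * Real.exp (-1) * Real.exp (-u ^ 2)) := by
        simp
    _ ≤ ∫⁻ x in Set.Ioc u (u + 1), gaussianPDF 0 1 x := by
        refine setLIntegral_mono (measurable_gaussianPDF 0 1) fun x hx => ?_
        refine ENNReal.ofReal_le_ofReal ?_
        rw [gaussianPDFReal, mul_assoc, ← Real.exp_add]
        simp only [NNReal.coe_one, mul_one, sub_zero]
        refine mul_le_mul_of_nonneg_left (Real.exp_le_exp.2 ?_) (by positivity)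
        have h1 : x ^ 2 ≤ (u + 1) ^ 2 := by
          have : 0 ≤ x := hu.trans hx.1.le
          exact pow_le_pow_left₀ this hx.2 2
        nlinarith [sq_nonneg (u - 1)]
    _ ≤ ∫⁻ x in Set.Ioi u, gaussianPDF 0 1 x :=
        lintegral_mono_set Set.Ioc_subset_Ioi_self

theorem gaussianReal_Iio_neg (u : ℝ) :
    gaussianReal 0 1 (Set.Iio (-u)) = gaussianReal 0 1 (Set.Ioi u) := by
  have h : (gaussianReal 0 1).map (fun x => -x) = gaussianReal 0 1 := by
    rw [gaussianReal_map_neg, neg_zero]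
  conv_lhs => rw [← h, Measure.map_apply measurable_neg measurableSet_Iio]
  congr 1
  ext x; simp

/-- The probability that a shifted normal variable lies in a symmetric interval. -/
theorem gaussianReal_shift_le (w : ℝ) {s u : ℝ} (hs : 0 < s) (hu : 0 ≤ u) :
    gaussianReal 0 1 {x | |s * x + w| ≤ s * u} ≤
      ENNReal.ofReal (1 - (√(2 * Real.pi))⁻¹ * Real.exp (-1) * Real.exp (-u ^ 2)) := by
  set p := (√(2 * Real.pi))⁻¹ * Real.exp (-1) * Real.exp (-u ^ 2)
  have hp0 : 0 ≤ p := by positivity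
  have hm : MeasurableSet {x : ℝ | |s * x + w| ≤ s * u} :=
    measurableSet_le (by fun_prop) measurable_const
  have hcompl : ENNReal.ofReal p ≤ gaussianReal 0 1 {x : ℝ | |s * x + w| ≤ s * u}ᶜ := by
    rcases le_total 0 w with hw | hw
    · refine (gaussianReal_Ioi_ge hu).trans (measure_mono fun x hx => ?_)
      rw [Set.mem_compl_iff, Set.mem_ofPred_eq, not_le]
      have : s * u < s * x := mul_lt_mul_of_pos_left hx hs
      exact lt_of_lt_of_le (by linarith) (le_abs_self _)
    · refine ((gaussianReal_Ioi_ge hu).trans_eq (gaussianReal_Iio_neg u).symm).trans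
        (measure_mono fun x hx => ?_)
      rw [Set.mem_compl_iff, Set.mem_ofPred_eq, not_le]
      have : s * x < s * (-u) := mul_lt_mul_of_pos_left hx hs
      exact lt_of_lt_of_le (by linarith) (neg_le_abs _)
  rw [ENNReal.ofReal_sub _ hp0, ENNReal.ofReal_one]
  refine ENNReal.le_sub_of_add_le_right ENNReal.ofReal_ne_top ?_
  calc _ ≤ gaussianReal 0 1 {x : ℝ | |s * x + w| ≤ s * u} +
        gaussianReal 0 1 {x : ℝ | |s * x + w| ≤ s * u}ᶜ := add_le_add_right hcompl _
    _ = 1 := prob_add_prob_compl hm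

/-- The lower tail constant of the normal distribution. -/
def normalTailConst : ℝ := (√(2 * Real.pi))⁻¹ * Real.exp (-1)

theorem noise_grid_le (m : ℕ) (t : ℝ) (g : Fin (2 * m + 1) → ℝ) {s u : ℝ} (hs : 0 < s)
    (hu : 0 ≤ u) :
    noise {z | ∀ j : Fin (2 * m + 1), |s * ((√((2 * m + 1 : ℕ) : ℝ))⁻¹ *
      ∑ k ∈ Finset.range (2 * m + 1), fourierFun k (j / (2 * m + 1 : ℕ) + t) * z k) + g j| ≤
      s * u} ≤ ENNReal.ofReal (1 - normalTailConst * Real.exp (-u ^ 2)) ^ (2 * m + 1) := by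
  have hmeas : Measurable (fun (z : ℕ → ℝ) (j : Fin (2 * m + 1)) => (√((2 * m + 1 : ℕ) : ℝ))⁻¹ *
      ∑ k ∈ Finset.range (2 * m + 1), fourierFun k (j / (2 * m + 1 : ℕ) + t) * z k) := by
    refine measurable_pi_lambda _ fun j => Measurable.const_mul
      (Finset.measurable_fun_sum _ fun k _ => ?_) _
    exact (measurable_const_mul _).comp (measurable_pi_apply k)
  have hset : MeasurableSet (Set.pi Set.univ fun j : Fin (2 * m + 1) =>
      {x : ℝ | |s * x + g j| ≤ s * u}) :=
    MeasurableSet.univ_pi fun j => measurableSet_le (by fun_prop) measurable_const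
  have h := Measure.map_apply (μ := noise) hmeas hset
  rw [noise_map_grid, Measure.pi_pi] at h
  have heq : {z : ℕ → ℝ | ∀ j : Fin (2 * m + 1), |s * ((√((2 * m + 1 : ℕ) : ℝ))⁻¹ *
      ∑ k ∈ Finset.range (2 * m + 1), fourierFun k (j / (2 * m + 1 : ℕ) + t) * z k) + g j| ≤
      s * u} = (fun (z : ℕ → ℝ) (j : Fin (2 * m + 1)) => (√((2 * m + 1 : ℕ) : ℝ))⁻¹ *
      ∑ k ∈ Finset.range (2 * m + 1), fourierFun k (j / (2 * m + 1 : ℕ) + t) * z k) ⁻¹'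
      (Set.pi Set.univ fun j : Fin (2 * m + 1) => {x : ℝ | |s * x + g j| ≤ s * u}) := by
    ext z; simp [Set.mem_pi]
  rw [heq, ← h]
  refine (Finset.prod_le_prod' fun j _ => gaussianReal_shift_le (g j) hs hu).trans (le_of_eq ?_)
  rw [Finset.prod_const, Finset.card_univ, Fintype.card_fin]; rfl

/-- A random trigonometric polynomial with equal variances, shifted by a fixed function, is rarely
small in the sup-norm. -/
theorem noise_supN_shift_le_le (m : ℕ) {η : ℕ → ℝ} (hη : SqSummable η) {b u : ℝ} (hb : 0 < b)
    (hu : 0 ≤ u) :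
    noise {z | supN ((fun k => (if k < 2 * m + 1 then b else 0) * z k) + η) ≤
      ENNReal.ofReal (b * √((2 * m + 1 : ℕ) : ℝ) * u)} ≤
      ENNReal.ofReal (1 - normalTailConst * Real.exp (-u ^ 2)) ^ (2 * m + 1) := by
  set N : ℕ := 2 * m + 1
  have hN0 : (0 : ℝ) < (N : ℝ) := by positivity
  set r := b * √(N : ℝ) * u
  have hr0 : 0 ≤ r := by positivity
  set g : ℝ → ℝ := fun x => fourierSum η x
  have hgm : Measurable g := (Lp.stronglyMeasurable (fourierSum η)).measurable
  set P : (ℕ → ℝ) → ℝ → ℝ := fun z x => ∑ k ∈ Finset.range N, fourierFun k x * z k with hP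
  set E : Set (ℕ → ℝ) := {z | supN ((fun k => (if k < N then b else 0) * z k) + η) ≤
    ENNReal.ofReal r}
  have hEm : MeasurableSet E := by
    refine measurableSet_le (measurable_supN.comp (measurable_pi_lambda _ fun k => ?_))
      measurable_const
    have h1 : Measurable fun z : ℕ → ℝ => (if k < N then b else 0) * z k :=
      (measurable_const_mul _).comp (measurable_pi_apply k)
    exact h1.add_const (η k)
  have hae : ∀ z ∈ E, ∀ᵐ x ∂(volume : Measure ℝ), x ∈ Set.Icc (0 : ℝ) 1 →
      |b * P z x + g x| ≤ r := by
    intro z hz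
    have hfin : ∀ k ∉ Finset.range N, (if k < N then b else 0) * z k = 0 := fun k hk => by
      simp only [Finset.mem_range] at hk; simp [hk]
    have hz' := (supN_le_ofReal_iff hr0).1 hz
    rw [fourierSum_add (sqSummable_of_finite _ hfin) hη] at hz'
    rw [← ae_restrict_iff' measurableSet_Icc]
    filter_upwards [hz', Lp.coeFn_add (fourierSum fun k => (if k < N then b else 0) * z k)
      (fourierSum η), fourierSum_of_finite_ae _ hfin] with x h1 h2 h3
    rw [h2, Pi.add_apply, h3] at h1
    convert h1 using 3
    rw [hP, Finset.mul_sum]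
    refine Finset.sum_congr rfl fun k hk => ?_
    rw [if_pos (Finset.mem_range.1 hk)]; ring
  set Q : (ℕ → ℝ) → ℝ → Prop := fun z t => z ∈ E → ∀ j : Fin N,
    |b * P z (j / (N : ℕ) + t) + g (j / (N : ℕ) + t)| ≤ r with hQ
  set τ : Measure ℝ := volume.restrict (Set.Ioo 0 (1 / (N : ℝ))) with hτ
  have hQae : ∀ᵐ z ∂noise, ∀ᵐ t ∂τ, Q z t := by
    refine ae_of_all _ fun z => ?_
    by_cases hz : z ∈ E
    · have : ∀ᵐ t ∂τ, ∀ j : Fin N,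
          |b * P z (j / (N : ℕ) + t) + g (j / (N : ℕ) + t)| ≤ r := by
        rw [ae_all_iff]
        intro j
        rw [hτ, ae_restrict_iff' measurableSet_Ioo]
        have hshift := (measurePreserving_add_left (volume : Measure ℝ)
          ((j : ℝ) / (N : ℕ))).quasiMeasurePreserving.ae (hae z hz)
        filter_upwards [hshift] with t ht htI
        refine ht ⟨add_nonneg (by positivity) htI.1.le, ?_⟩
        have h1 : ((j : ℕ) : ℝ) + 1 ≤ N := by exact_mod_cast j.2
        have h2 : ((j : ℕ) : ℝ) / N + 1 / N ≤ 1 := by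
          rw [← add_div, div_le_one hN0]; exact h1
        linarith [htI.2]
      filter_upwards [this] with t ht _ using ht
    · exact ae_of_all _ fun t h => absurd h hz
  have hPm : ∀ c : ℝ, Measurable fun q : (ℕ → ℝ) × ℝ => P q.1 (c + q.2) := fun c => by
    refine Finset.measurable_fun_sum _ fun k _ => Measurable.mul ?_ ?_
    · exact (continuous_fourierFun k).measurable.comp (measurable_snd.const_add c)
    · exact (measurable_pi_apply k).comp measurable_fst
  have hQm : MeasurableSet {q : (ℕ → ℝ) × ℝ | Q q.1 q.2} := by
    have h1 : {q : (ℕ → ℝ) × ℝ | Q q.1 q.2} = (Prod.fst ⁻¹' E)ᶜ ∪ ⋂ j : Fin N,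
        {q | |b * P q.1 (j / (N : ℕ) + q.2) + g (j / (N : ℕ) + q.2)| ≤ r} := by
      ext q
      simp only [hQ, Set.mem_ofPred_eq, Set.mem_union, Set.mem_compl_iff, Set.mem_preimage,
        Set.mem_iInter]
      tauto
    rw [h1]
    refine (measurable_fst hEm).compl.union (MeasurableSet.iInter fun j => ?_)
    refine measurableSet_le ?_ measurable_const
    refine continuous_abs.measurable.comp (((hPm _).const_mul b).add ?_)
    exact hgm.comp (measurable_snd.const_add _)
  have hswap := (Measure.ae_ae_comm hQm).1 hQae
  have hτ0 : (ae τ).NeBot := by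
    rw [ae_neBot, hτ, Ne, Measure.restrict_eq_zero, Real.volume_Ioo]
    simp
  obtain ⟨t, ht⟩ := hswap.exists
  have hb' : ∀ z : ℕ → ℝ, ∀ x, b * P z x = b * √(N : ℝ) * ((√(N : ℝ))⁻¹ * P z x) := fun z x => by
    have : √(N : ℝ) ≠ 0 := (Real.sqrt_pos.2 hN0).ne'
    field_simp
  refine le_trans (measure_mono_ae ?_) (noise_grid_le m t (fun j => g (j / (N : ℕ) + t))
    (s := b * √(N : ℝ)) (by positivity) hu)
  filter_upwards [ht] with z hz hzE j
  have := hz hzE j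
  rw [hb'] at this
  exact this

/-- A lower bound for the sup-norm of a Gaussian series whose first variances are at least
`b ^ 2`. -/
theorem noise_supN_le_le (m : ℕ) {σ : ℕ → ℝ} (hσ : SqSummable σ) {b u : ℝ} (hb : 0 < b)
    (hbσ : ∀ k < 2 * m + 1, b ≤ σ k) (hu : 0 ≤ u) :
    noise {z | supN (fun k => σ k * z k) ≤
      ENNReal.ofReal (b * √((2 * m + 1 : ℕ) : ℝ) * u)} ≤
      ENNReal.ofReal (1 - normalTailConst * Real.exp (-u ^ 2)) ^ (2 * m + 1) := by
  set A : ℕ → ℝ := fun k => if k < 2 * m + 1 then b / σ k else 0 with hA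
  have hA01 : ∀ k, 0 ≤ A k ∧ A k ≤ 1 := fun k => by
    simp only [hA]
    split_ifs with hk
    · have := hbσ k hk
      exact ⟨div_nonneg hb.le (hb.le.trans this), (div_le_one (hb.trans_le this)).2 this⟩
    · exact ⟨le_rfl, zero_le_one⟩
  set B : ℕ → ℝ := fun k => √(1 - A k ^ 2) with hB
  have hAB : ∀ k, A k ^ 2 + B k ^ 2 = 1 := fun k => by
    have h1 : A k ^ 2 ≤ 1 := pow_le_one₀ (hA01 k).1 (hA01 k).2
    rw [hB, Real.sq_sqrt (by linarith)]; ring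
  have hm : MeasurableSet {z : ℕ → ℝ | supN (fun k => σ k * z k) ≤
      ENNReal.ofReal (b * √((2 * m + 1 : ℕ) : ℝ) * u)} :=
    measurableSet_le (measurable_supN_mul σ) measurable_const
  have hsplit : Measurable fun (p : (ℕ → ℝ) × (ℕ → ℝ)) k => A k * p.1 k + B k * p.2 k := by
    refine measurable_pi_lambda _ fun k => Measurable.add ?_ ?_
    · exact (measurable_const_mul _).comp ((measurable_pi_apply k).comp measurable_fst)
    · exact (measurable_const_mul _).comp ((measurable_pi_apply k).comp measurable_snd)
  have hBσ : SqSummable fun k => σ k * B k := hσ.mono fun k => by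
    rw [abs_mul]
    refine mul_le_of_le_one_right (abs_nonneg _) ?_
    rw [hB, abs_of_nonneg (Real.sqrt_nonneg _), Real.sqrt_le_one]
    linarith [sq_nonneg (A k)]
  have hdecomp : ∀ z y : ℕ → ℝ, (fun k => σ k * (A k * z k + B k * y k)) =
      (fun k => (if k < 2 * m + 1 then b else 0) * z k) + fun k => σ k * B k * y k := by
    intro z y
    ext k
    simp only [hA, Pi.add_apply]
    split_ifs with hk
    · have := (hb.trans_le (hbσ k hk)).ne'
      field_simp
    · ring
  conv_lhs => rw [← noise_prod_map_add hAB]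
  rw [Measure.map_apply hsplit hm, Measure.prod_apply_symm (hsplit hm)]
  calc _ ≤ ∫⁻ _, ENNReal.ofReal (1 - normalTailConst * Real.exp (-u ^ 2)) ^ (2 * m + 1) ∂noise := by
        refine lintegral_mono_ae ?_
        filter_upwards [ae_sqSummable_mul hBσ] with y hy
        refine le_trans (measure_mono fun z hz => ?_) (noise_supN_shift_le_le m hy hb hu)
        have hz' : supN (fun k => σ k * (A k * z k + B k * y k)) ≤
          ENNReal.ofReal (b * √((2 * m + 1 : ℕ) : ℝ) * u) := hz
        rw [hdecomp] at hz'
        exact hz'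
    _ = _ := by rw [lintegral_const, measure_univ, mul_one]

/-- The constant in the lower bound for the sup-norm. -/
def lowerConst (α : ℝ) : ℝ := √(1 / (12 * (2 * α + 1)))

/-- If the first `n ^ (1 / (2 * α + 1))` variances are at least `1 / (2 * n)`, the sup-norm is at least of
the order of the rate with probability tending to one. -/
theorem tendsto_noise_supN_le {α : ℝ} (hα : 0 < α) {σ : ℕ → ℕ → ℝ} (hσ : ∀ n, SqSummable (σ n))
    (hlow : ∀ n k : ℕ, 1 ≤ n → ((k : ℝ) + 1) ^ (2 * α + 1) ≤ n → √(1 / (2 * n)) ≤ σ n k) :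
    Tendsto (fun n : ℕ => noise {z | supN (fun k => σ n k * z k) ≤
      ENNReal.ofReal (lowerConst α * rate α n)}) atTop (𝓝 0) := by
  have hp0 : 0 < 2 * α + 1 := by positivity
  set κ := normalTailConst with hκ
  have hκ0 : 0 < κ := by rw [hκ, normalTailConst]; positivity
  have hbound : ∀ n : ℕ, 1 ≤ n → noise {z | supN (fun k => σ n k * z k) ≤
      ENNReal.ofReal (lowerConst α * rate α n)} ≤
      ENNReal.ofReal (Real.exp (-(κ / 3 * (n : ℝ) ^ (1 / (2 * (2 * α + 1)))))) := by
    intro n hn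
    have hn1 : (1 : ℝ) ≤ n := by exact_mod_cast hn
    have hn0 : (0 : ℝ) < n := by linarith
    set J : ℝ := (n : ℝ) ^ (1 / (2 * α + 1)) with hJ
    have hJ1 : 1 ≤ J := Real.one_le_rpow hn1 (by positivity)
    have hJp : J ^ (2 * α + 1) = n := by
      rw [hJ, ← Real.rpow_mul hn0.le, one_div, inv_mul_cancel₀ hp0.ne', Real.rpow_one]
    set m : ℕ := ⌊(J - 1) / 2⌋₊
    have hm1 : (m : ℝ) ≤ (J - 1) / 2 := Nat.floor_le (by linarith)
    have hm2 : (J - 1) / 2 < m + 1 := Nat.lt_floor_add_one _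
    set N : ℝ := ((2 * m + 1 : ℕ) : ℝ) with hN
    have hNe : N = 2 * m + 1 := by rw [hN]; push_cast; ring
    have hNJ : N ≤ J := by linarith
    have hN3 : J / 3 ≤ N := by
      rcases le_or_gt J 3 with h | h <;> linarith
    have hN0 : 0 < N := by linarith
    set b : ℝ := √(1 / (2 * n)) with hb
    have hb0 : 0 < b := Real.sqrt_pos.2 (by positivity)
    have hbσ : ∀ k < 2 * m + 1, b ≤ σ n k := fun k hk => by
      refine hlow n k hn ?_
      have : (k : ℝ) + 1 ≤ N := by rw [hN]; exact_mod_cast hk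
      calc ((k : ℝ) + 1) ^ (2 * α + 1) ≤ J ^ (2 * α + 1) :=
            Real.rpow_le_rpow (by positivity) (this.trans hNJ) hp0.le
        _ = n := hJp
    set r := lowerConst α * rate α n with hr
    have hr0 : 0 ≤ r := by rw [hr, lowerConst, rate]; positivity
    set u := r / (b * √N) with hu
    have hbN : 0 < b * √N := mul_pos hb0 (Real.sqrt_pos.2 hN0)
    have hu0 : 0 ≤ u := by positivity
    have hru : r = b * √N * u := by rw [hu, mul_div_cancel₀ _ hbN.ne']
    have hl0 : 0 ≤ Real.log n := Real.log_nonneg hn1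
    have hu2 : u ^ 2 ≤ 1 / (2 * (2 * α + 1)) * Real.log n := by
      have h1 : r ^ 2 = 1 / (12 * (2 * α + 1)) * ((J / n) * Real.log n) := by
        rw [hr, lowerConst, rate, mul_pow, mul_pow, Real.sq_sqrt (by positivity), Real.sq_sqrt hl0]
        congr 2
        rw [hJ, ← Real.rpow_sub_one hn0.ne', ← Real.rpow_natCast, ← Real.rpow_mul hn0.le]
        congr 1
        push_cast
        field_simp
        ring
      have h2 : (b * √N) ^ 2 = N / (2 * n) := by
        rw [mul_pow, hb, Real.sq_sqrt (by positivity), Real.sq_sqrt hN0.le]; ring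
      rw [hu, div_pow, h1, h2, div_le_iff₀ (by positivity)]
      have h3 : J / n * Real.log n ≤ 3 * (N / n) * Real.log n := by
        refine mul_le_mul_of_nonneg_right ?_ hl0
        rw [mul_div_assoc', div_le_div_iff_of_pos_right hn0]; linarith
      calc 1 / (12 * (2 * α + 1)) * (J / n * Real.log n)
          ≤ 1 / (12 * (2 * α + 1)) * (3 * (N / n) * Real.log n) :=
            mul_le_mul_of_nonneg_left h3 (by positivity)
        _ = 1 / (2 * (2 * α + 1)) * Real.log n * (N / (2 * n)) := by field_simp; ring
    have hexp : (n : ℝ) ^ (-(1 / (2 * (2 * α + 1)))) ≤ Real.exp (-u ^ 2) := by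
      rw [Real.rpow_def_of_pos hn0, Real.exp_le_exp]; linarith
    rw [hru]
    refine (noise_supN_le_le m (hσ n) hb0 hbσ hu0).trans ?_
    have hle : ENNReal.ofReal (1 - κ * Real.exp (-u ^ 2)) ≤
        ENNReal.ofReal (Real.exp (-(κ * Real.exp (-u ^ 2)))) :=
      ENNReal.ofReal_le_ofReal (Real.one_sub_le_exp_neg _)
    refine (pow_le_pow_left₀ zero_le hle _).trans ?_
    rw [← ENNReal.ofReal_pow (Real.exp_pos _).le, ← Real.exp_nat_mul]
    refine ENNReal.ofReal_le_ofReal (Real.exp_le_exp.2 ?_)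
    rw [← hN, mul_neg, neg_le_neg_iff]
    calc κ / 3 * (n : ℝ) ^ (1 / (2 * (2 * α + 1)))
        = J / 3 * (κ * (n : ℝ) ^ (-(1 / (2 * (2 * α + 1))))) := by
          have : (n : ℝ) ^ (1 / (2 * (2 * α + 1))) =
              J * (n : ℝ) ^ (-(1 / (2 * (2 * α + 1)))) := by
            rw [hJ, ← Real.rpow_add hn0]; congr 1; field_simp; ring
          rw [this]; ring
      _ ≤ N * (κ * Real.exp (-u ^ 2)) := by gcongr
  have hlim : Tendsto (fun n : ℕ => ENNReal.ofReal
      (Real.exp (-(κ / 3 * (n : ℝ) ^ (1 / (2 * (2 * α + 1))))))) atTop (𝓝 0) := by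
    have h1 : Tendsto (fun n : ℕ => κ / 3 * (n : ℝ) ^ (1 / (2 * (2 * α + 1)))) atTop atTop :=
      ((tendsto_rpow_atTop (by positivity)).comp tendsto_natCast_atTop_atTop).const_mul_atTop
        (by positivity)
    have h2 := ENNReal.tendsto_ofReal
      (Real.tendsto_exp_atBot.comp (tendsto_neg_atTop_atBot.comp h1))
    rw [ENNReal.ofReal_zero] at h2
    exact h2
  refine tendsto_of_tendsto_of_tendsto_of_le_of_le' tendsto_const_nhds hlim
    (Eventually.of_forall fun _ => zero_le) ?_
  exact (eventually_ge_atTop 1).mono hbound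

/-! ### Shifts of the noise -/

theorem lintegral_noise_prod (M : ℕ) {f : ℕ → ℝ → ℝ≥0∞} (hf : ∀ k, Measurable (f k)) :
    ∫⁻ z, ∏ k ∈ Finset.range M, f k (z k) ∂noise =
      ∏ k ∈ Finset.range M, ∫⁻ x, f k x ∂gaussianReal 0 1 := by
  have hind : iIndepFun (fun (k : ℕ) (z : ℕ → ℝ) => f k (z k)) noise := iIndepFun_infinitePi hf
  rw [lintegral_prod_eq_prod_lintegral_of_indepFun _ _ hind
    fun k => (hf k).comp (measurable_pi_apply k)]
  refine Finset.prod_congr rfl fun k _ => ?_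
  rw [← noise_map_eval k, lintegral_map (hf k) (measurable_pi_apply k)]

/-- The density of `N(a, 1)` with respect to `N(0, 1)`. -/
def shiftDensity (a x : ℝ) : ℝ≥0∞ := ENNReal.ofReal (Real.exp (a * x - a ^ 2 / 2))

theorem measurable_shiftDensity (a : ℝ) : Measurable (shiftDensity a) := by
  unfold shiftDensity; fun_prop

theorem gaussianReal_withDensity_shiftDensity (a : ℝ) :
    (gaussianReal 0 1).withDensity (shiftDensity a) = gaussianReal a 1 := by
  rw [gaussianReal_of_var_ne_zero _ one_ne_zero, gaussianReal_of_var_ne_zero _ one_ne_zero,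
    ← withDensity_mul _ (measurable_gaussianPDF 0 1) (measurable_shiftDensity a)]
  congr 1
  ext x
  rw [Pi.mul_apply, gaussianPDF, gaussianPDF, shiftDensity,
    ← ENNReal.ofReal_mul (gaussianPDFReal_nonneg _ _ _)]
  congr 1
  rw [gaussianPDFReal, gaussianPDFReal, mul_assoc, ← Real.exp_add]
  congr 2
  simp only [NNReal.coe_one]
  ring

theorem lintegral_shiftDensity_sq (a : ℝ) :
    ∫⁻ x, shiftDensity a x ^ 2 ∂gaussianReal 0 1 = ENNReal.ofReal (Real.exp (a ^ 2)) := by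
  have h1 : ∀ x, shiftDensity a x ^ 2 =
      ENNReal.ofReal (Real.exp (-a ^ 2) * Real.exp (2 * a * x)) := fun x => by
    rw [shiftDensity, ← ENNReal.ofReal_pow (Real.exp_pos _).le, ← Real.exp_nat_mul, ← Real.exp_add]
    congr 2; push_cast; ring
  simp_rw [h1]
  rw [← ofReal_integral_eq_lintegral_ofReal ((integrable_exp_mul_gaussianReal _).const_mul _)
    (ae_of_all _ fun x => by positivity), integral_const_mul]
  have h2 := congrFun (mgf_id_gaussianReal (μ := 0) (v := 1)) (2 * a)
  simp only [mgf, id] at h2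
  rw [h2, ← Real.exp_add]
  congr 2; push_cast; ring

/-- The law of finitely many shifted noise coordinates. -/
theorem noise_map_shift_trunc (N : ℕ) (h : ℕ → ℝ) :
    noise.map (fun z k => trunc N h k + z k) =
      noise.withDensity fun z => ∏ k ∈ Finset.range N, shiftDensity (h k) (z k) := by
  have hmap : noise.map (fun z k => trunc N h k + z k) =
      Measure.infinitePi fun k => gaussianReal (trunc N h k) 1 := by
    have := Measure.infinitePi_map_pi (fun _ : ℕ => gaussianReal 0 1)
      (f := fun k x => trunc N h k + x) fun k => measurable_const_add _
    simp_rw [gaussianReal_map_const_add, zero_add] at this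
    exact this
  rw [hmap]
  symm
  refine Measure.eq_infinitePi _ fun s t ht => ?_
  obtain ⟨M, hNM, hsM⟩ : ∃ M, N ≤ M ∧ s ⊆ Finset.range M := by
    refine ⟨max N (s.sup id + 1), le_max_left _ _, fun k hk => ?_⟩
    rw [Finset.mem_range]
    exact (Nat.lt_succ_of_le (Finset.le_sup (f := id) hk)).trans_le (le_max_right _ _)
  have hpi : MeasurableSet (Set.pi (s : Set ℕ) t) :=
    MeasurableSet.pi s.countable_toSet fun k _ => ht k
  set f : ℕ → ℝ → ℝ≥0∞ := fun k =>
    (if k ∈ s then t k else Set.univ).indicator (shiftDensity (trunc N h k)) with hf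
  have htm : ∀ k, MeasurableSet (if k ∈ s then t k else Set.univ) := fun k => by
    split_ifs
    · exact ht k
    · exact MeasurableSet.univ
  have hfm : ∀ k, Measurable (f k) := fun k => (measurable_shiftDensity _).indicator (htm k)
  have heqn : ∀ k, ∫⁻ x, f k x ∂gaussianReal 0 1 =
      if k ∈ s then gaussianReal (trunc N h k) 1 (t k) else 1 := fun k => by
    rw [hf, lintegral_indicator (htm k), ← withDensity_apply _ (htm k),
      gaussianReal_withDensity_shiftDensity]
    split_ifs <;> simp
  have hprod : ∀ z : ℕ → ℝ, (Set.pi (s : Set ℕ) t).indicator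
      (fun z => ∏ k ∈ Finset.range N, shiftDensity (h k) (z k)) z =
      ∏ k ∈ Finset.range M, f k (z k) := fun z => by
    have h1 : ∏ k ∈ Finset.range N, shiftDensity (h k) (z k) =
        ∏ k ∈ Finset.range M, shiftDensity (trunc N h k) (z k) := by
      rw [← Finset.prod_range_mul_prod_Ico _ hNM, Finset.prod_eq_one (s := Finset.Ico N M), mul_one]
      · refine Finset.prod_congr rfl fun k hk => ?_
        rw [trunc, if_pos (Finset.mem_range.1 hk)]
      · intro k hk
        rw [trunc, if_neg (not_lt.2 (Finset.mem_Ico.1 hk).1)]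
        simp [shiftDensity]
    by_cases hz : z ∈ Set.pi (s : Set ℕ) t
    · rw [Set.indicator_of_mem hz, h1]
      refine Finset.prod_congr rfl fun k _ => ?_
      rw [hf]
      refine (Set.indicator_of_mem ?_ _).symm
      split_ifs with hk
      · exact hz k hk
      · trivial
    · rw [Set.indicator_of_notMem hz]
      rw [Set.mem_pi] at hz
      push Not at hz
      obtain ⟨k, hk, hkt⟩ := hz
      have hks : k ∈ s := hk
      refine (Finset.prod_eq_zero (hsM hks) ?_).symm
      rw [hf]
      refine Set.indicator_of_notMem ?_ _
      rwa [if_pos hks]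
  rw [withDensity_apply _ hpi, ← lintegral_indicator hpi]
  simp_rw [hprod]
  rw [lintegral_noise_prod M hfm]
  simp_rw [heqn]
  rw [Finset.prod_ite_mem, Finset.inter_eq_right.2 hsM]

theorem noise_shift_trunc_le {h : ℕ → ℝ} (hh : SqSummable h) (N : ℕ) {A : Set (ℕ → ℝ)}
    (hA : MeasurableSet A) :
    noise {z | (fun k => trunc N h k + z k) ∈ A} ≤
      ENNReal.ofReal (Real.exp (∑' k, h k ^ 2)) ^ (1 / 2 : ℝ) * noise A ^ (1 / 2 : ℝ) := by
  have hm : Measurable fun (z : ℕ → ℝ) k => trunc N h k + z k :=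
    measurable_pi_lambda _ fun k => (measurable_const_add _).comp (measurable_pi_apply k)
  have hdm : Measurable fun z : ℕ → ℝ => ∏ k ∈ Finset.range N, shiftDensity (h k) (z k) :=
    Finset.measurable_fun_prod _ fun k _ =>
      (measurable_shiftDensity (h k)).comp (measurable_pi_apply k)
  have h0 : noise {z | (fun k => trunc N h k + z k) ∈ A} =
      noise.map (fun z k => trunc N h k + z k) A := (Measure.map_apply hm hA).symm
  rw [h0, noise_map_shift_trunc, withDensity_apply _ hA, ← lintegral_indicator hA]
  have h1 : ∀ z : ℕ → ℝ, A.indicator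
      (fun z => ∏ k ∈ Finset.range N, shiftDensity (h k) (z k)) z =
      ((fun z : ℕ → ℝ => ∏ k ∈ Finset.range N, shiftDensity (h k) (z k)) * (A.indicator 1 : (ℕ → ℝ) → ℝ≥0∞)) z :=
    fun z => by
      by_cases hz : z ∈ A <;> simp [hz]
  simp_rw [h1]
  refine (ENNReal.lintegral_mul_le_Lp_mul_Lq noise Real.HolderConjugate.two_two hdm.aemeasurable
    (measurable_one.indicator hA).aemeasurable).trans ?_
  refine mul_le_mul' (ENNReal.rpow_le_rpow ?_ (by norm_num)) (ENNReal.rpow_le_rpow ?_ (by norm_num))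
  · simp_rw [ENNReal.rpow_two, ← Finset.prod_pow]
    rw [lintegral_noise_prod N (f := fun k x => shiftDensity (h k) x ^ 2)
      fun k => (measurable_shiftDensity (h k)).pow_const 2]
    simp_rw [lintegral_shiftDensity_sq]
    rw [← ENNReal.ofReal_prod_of_nonneg fun k _ => (Real.exp_pos _).le, ← Real.exp_sum]
    exact ENNReal.ofReal_le_ofReal (Real.exp_le_exp.2
      (Summable.sum_le_tsum _ (fun k _ => sq_nonneg _) hh))
  · rw [← lintegral_indicator_one hA]
    refine lintegral_mono fun z => ?_
    by_cases hz : z ∈ A <;> simp [hz]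

theorem noise_shift_le_of_isOpen {h : ℕ → ℝ} (hh : SqSummable h) {U : Set (ℕ → ℝ)}
    (hU : IsOpen U) :
    noise {z | (fun k => h k + z k) ∈ U} ≤
      ENNReal.ofReal (Real.exp (∑' k, h k ^ 2)) ^ (1 / 2 : ℝ) * noise U ^ (1 / 2 : ℝ) := by
  set S : ℕ → Set (ℕ → ℝ) := fun M => {z | ∀ N ≥ M, (fun k => trunc N h k + z k) ∈ U}
  have hsub : {z : ℕ → ℝ | (fun k => h k + z k) ∈ U} ⊆ ⋃ M, S M := by
    intro z hz
    have hlim : Tendsto (fun (N : ℕ) (k : ℕ) => trunc N h k + z k) atTop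
        (𝓝 fun k => h k + z k) := by
      rw [tendsto_pi_nhds]
      intro k
      refine tendsto_const_nhds.congr' ?_
      filter_upwards [eventually_gt_atTop k] with N hN
      rw [trunc, if_pos hN]
    obtain ⟨M, hM⟩ := eventually_atTop.1 (hlim.eventually (hU.mem_nhds hz))
    exact Set.mem_iUnion.2 ⟨M, hM⟩
  refine (measure_mono hsub).trans ?_
  have hmono : Monotone S := fun M M' hMM z hz N hN => hz N (hMM.trans hN)
  rw [hmono.measure_iUnion]
  refine iSup_le fun M => (measure_mono fun z hz => ?_).trans
    (noise_shift_trunc_le hh M hU.measurableSet)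
  exact hz M le_rfl

/-- Square summable shifts of the noise are absolutely continuous. -/
theorem noise_map_shift_absolutelyContinuous {h : ℕ → ℝ} (hh : SqSummable h) :
    noise.map (fun z k => h k + z k) ≪ noise := by
  have hm : Measurable fun (z : ℕ → ℝ) k => h k + z k :=
    measurable_pi_lambda _ fun k => (measurable_const_add _).comp (measurable_pi_apply k)
  intro A hA
  set C := ENNReal.ofReal (Real.exp (∑' k, h k ^ 2)) ^ (1 / 2 : ℝ)
  have hCtop : C ≠ ∞ := ENNReal.rpow_ne_top_of_nonneg (by norm_num) ENNReal.ofReal_ne_top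
  have hle : ∀ n : ℕ, noise.map (fun z k => h k + z k) A ≤
      C * ((n : ℝ≥0∞)⁻¹) ^ (1 / 2 : ℝ) := fun n => by
    obtain ⟨U, hAU, hU, hUn⟩ := A.exists_isOpen_le_add noise
      (ε := (n : ℝ≥0∞)⁻¹) (ENNReal.inv_ne_zero.2 (ENNReal.natCast_ne_top n))
    rw [hA, zero_add] at hUn
    refine (measure_mono hAU).trans ?_
    rw [Measure.map_apply hm hU.measurableSet]
    refine (noise_shift_le_of_isOpen hh hU).trans ?_
    gcongr
  have hlim : Tendsto (fun n : ℕ => C * ((n : ℝ≥0∞)⁻¹) ^ (1 / 2 : ℝ)) atTop (𝓝 0) := by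
    have h1 := (ENNReal.continuous_rpow_const (y := (1 / 2 : ℝ))).tendsto 0 |>.comp
      ENNReal.tendsto_inv_nat_nhds_zero
    rw [ENNReal.zero_rpow_of_pos (by norm_num)] at h1
    have h2 := ENNReal.Tendsto.const_mul h1 (Or.inr hCtop)
    rwa [mul_zero] at h2
  exact le_antisymm (ge_of_tendsto hlim (Eventually.of_forall hle)) zero_le

/-! ### The posterior -/

theorem measurable_affine (c s : ℕ → ℝ) :
    Measurable fun (p : (ℕ → ℝ) × (ℕ → ℝ)) k => c k * p.1 k + s k * p.2 k := by
  refine measurable_pi_lambda _ fun k => Measurable.add ?_ ?_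
  · exact (measurable_const_mul _).comp ((measurable_pi_apply k).comp measurable_fst)
  · exact (measurable_const_mul _).comp ((measurable_pi_apply k).comp measurable_snd)

theorem measurable_affine_right (c s y : ℕ → ℝ) :
    Measurable fun (z : ℕ → ℝ) k => c k * y k + s k * z k :=
  (measurable_affine c s).comp measurable_prodMk_left

/-- The Gaussian kernel with independent coordinates `N(c_k y_k, s_k ^ 2)`. -/
def gaussianKernel (c s : ℕ → ℝ) : Kernel (ℕ → ℝ) (ℕ → ℝ) where
  toFun y := noise.map fun z k => c k * y k + s k * z k
  measurable' := by
    refine Measure.measurable_of_measurable_coe _ fun A hA => ?_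
    have key := measurable_measure_prodMk_left (ν := noise) (measurable_affine c s hA)
    convert key using 2 with y
    rw [Measure.map_apply (measurable_affine_right c s y) hA]
    rfl

theorem gaussianKernel_apply (c s y : ℕ → ℝ) :
    gaussianKernel c s y = noise.map fun z k => c k * y k + s k * z k := rfl

instance (c s : ℕ → ℝ) : IsMarkovKernel (gaussianKernel c s) :=
  ⟨fun y => Measure.isProbabilityMeasure_map (μ := noise)
    (measurable_affine_right c s y).aemeasurable⟩

theorem dataLaw_eq (n : ℕ) : dataLaw n = gaussianKernel (fun _ => 1) fun _ => (√(n : ℝ))⁻¹ := by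
  ext y : 1
  rw [gaussianKernel_apply]
  simp_rw [one_mul]
  rfl

theorem compProd_gaussianKernel (μ : Measure (ℕ → ℝ)) [IsProbabilityMeasure μ] (c s : ℕ → ℝ) :
    μ ⊗ₘ gaussianKernel c s =
      (μ.prod noise).map fun p => (p.1, fun k => c k * p.1 k + s k * p.2 k) := by
  have hm : Measurable fun p : (ℕ → ℝ) × (ℕ → ℝ) =>
      (p.1, fun k => c k * p.1 k + s k * p.2 k) := measurable_fst.prodMk (measurable_affine c s)
  ext A hA
  rw [Measure.compProd_apply hA, Measure.map_apply hm hA, Measure.prod_apply (hm hA)]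
  refine lintegral_congr fun y => ?_
  rw [gaussianKernel_apply, Measure.map_apply (measurable_affine_right c s y)
    (measurable_prodMk_left hA)]
  rfl

theorem measurable_mul_seq (a : ℕ → ℝ) : Measurable fun (z : ℕ → ℝ) k => a k * z k :=
  measurable_pi_lambda _ fun k => (measurable_const_mul _).comp (measurable_pi_apply k)

/-- The prior variances. -/
def priorVar (α : ℝ) (k : ℕ) : ℝ := ((k : ℝ) + 1) ^ (-(2 * α + 1))

theorem priorVar_pos (α : ℝ) (k : ℕ) : 0 < priorVar α k := by unfold priorVar; positivity

theorem prior_eq (α : ℝ) : prior α = noise.map fun z k => √(priorVar α k) * z k := by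
  have h := Measure.infinitePi_map_pi (fun _ : ℕ => gaussianReal 0 1)
    (f := fun k x => √(priorVar α k) * x) fun k => measurable_const_mul _
  refine Eq.trans ?_ h.symm
  rw [prior]
  congr 1
  ext k : 1
  rw [gaussianReal_map_const_mul, mul_zero, mul_one]
  congr 1
  refine NNReal.eq ?_
  change _ = √(priorVar α k) ^ 2
  rw [Real.sq_sqrt (priorVar_pos α k).le, priorVar, NNReal.coe_rpow]
  push_cast
  rfl

/-- The posterior shrinkage factors. -/
def shrink (α : ℝ) (n k : ℕ) : ℝ := n * priorVar α k / (1 + n * priorVar α k)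

/-- The posterior standard deviations. -/
def postDev (α : ℝ) (n k : ℕ) : ℝ := √(priorVar α k / (1 + n * priorVar α k))

/-- The joint law of the data and the parameter. -/
theorem joint_law (α : ℝ) {n : ℕ} (hn : 1 ≤ n) :
    (noise.prod noise).map (fun p => ((fun k => √(priorVar α k) * p.1 k + (√(n : ℝ))⁻¹ * p.2 k),
      fun k => √(priorVar α k) * p.1 k) : (ℕ → ℝ) × (ℕ → ℝ) → (ℕ → ℝ) × (ℕ → ℝ)) =
    (noise.prod noise).map (fun p => ((fun k => √(priorVar α k + (n : ℝ)⁻¹) * p.1 k),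
      fun k => shrink α n k * (√(priorVar α k + (n : ℝ)⁻¹) * p.1 k) + postDev α n k * p.2 k)) := by
  have hn0 : (0 : ℝ) < n := by exact_mod_cast hn
  set v : ℕ → ℝ := fun k => priorVar α k + (n : ℝ)⁻¹ with hv
  have hv0 : ∀ k, 0 < v k := fun k => add_pos (priorVar_pos α k) (by positivity)
  set a : ℕ → ℝ := fun k => √(priorVar α k) / √(v k) with ha
  set b : ℕ → ℝ := fun k => (√(n : ℝ))⁻¹ / √(v k) with hb
  have hl2 : ∀ k, √(priorVar α k) ^ 2 = priorVar α k := fun k => Real.sq_sqrt (priorVar_pos α k).le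
  have hv2 : ∀ k, √(v k) ^ 2 = v k := fun k => Real.sq_sqrt (hv0 k).le
  have hvs : ∀ k, √(v k) ≠ 0 := fun k => (Real.sqrt_pos.2 (hv0 k)).ne'
  have hn2 : (√(n : ℝ))⁻¹ ^ 2 = (n : ℝ)⁻¹ := by rw [inv_pow, Real.sq_sqrt hn0.le]
  have hab : ∀ k, a k ^ 2 + b k ^ 2 = 1 := fun k => by
    rw [ha, hb, div_pow, div_pow, hl2, hv2, hn2, ← add_div]
    exact div_self (hv0 k).ne'
  have hΨ : Measurable fun p : (ℕ → ℝ) × (ℕ → ℝ) =>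
      (((fun k => √(priorVar α k) * p.1 k + (√(n : ℝ))⁻¹ * p.2 k),
      fun k => √(priorVar α k) * p.1 k) : (ℕ → ℝ) × (ℕ → ℝ)) :=
    (measurable_affine _ fun _ => (√(n : ℝ))⁻¹).prodMk ((measurable_mul_seq _).comp measurable_fst)
  have hrot : Measurable fun p : (ℕ → ℝ) × (ℕ → ℝ) =>
      (((fun k => a k * p.1 k + b k * p.2 k), fun k => b k * p.1 k - a k * p.2 k) :
        (ℕ → ℝ) × (ℕ → ℝ)) := by
    refine (measurable_affine a b).prodMk ?_
    have := measurable_affine b (-a)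
    simpa [sub_eq_add_neg] using this
  conv_lhs => rw [← noise_prod_map_rotate hab]
  rw [Measure.map_map hΨ hrot]
  congr 1
  ext p k
  · simp only [Function.comp_apply]
    have h1 : √(priorVar α k) * a k + (√(n : ℝ))⁻¹ * b k = √(v k) := by
      rw [ha, hb]
      simp only
      rw [mul_div_assoc', mul_div_assoc', ← add_div, ← sq, ← sq, hl2, hn2, div_eq_iff (hvs k), ← sq,
        hv2]
    have h2 : √(priorVar α k) * b k - (√(n : ℝ))⁻¹ * a k = 0 := by
      rw [ha, hb]; simp only; ring
    linear_combination p.1 k * h1 + p.2 k * h2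
  · simp only [Function.comp_apply]
    have hnv : (n : ℝ) * v k = 1 + n * priorVar α k := by
      rw [hv]; simp only; field_simp; ring
    have h1 : √(priorVar α k) * a k = shrink α n k * √(v k) := by
      rw [ha, shrink]
      simp only
      rw [mul_div_assoc', ← sq, hl2, div_eq_iff (hvs k), mul_assoc, ← sq, hv2, ← hnv]
      have := (hv0 k).ne'
      field_simp
    have h2 : √(priorVar α k) * b k = postDev α n k := by
      rw [hb, postDev, ← hnv, Real.sqrt_div (priorVar_pos α k).le, Real.sqrt_mul hn0.le]
      simp only
      have : √(n : ℝ) ≠ 0 := (Real.sqrt_pos.2 hn0).ne'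
      have := hvs k
      field_simp
    linear_combination p.1 k * h1 + p.2 k * h2

theorem prior_compProd_dataLaw (α : ℝ) (n : ℕ) :
    (prior α ⊗ₘ dataLaw n).map Prod.swap =
    (noise.prod noise).map (fun p => ((fun k => √(priorVar α k) * p.1 k + (√(n : ℝ))⁻¹ * p.2 k),
      fun k => √(priorVar α k) * p.1 k) : (ℕ → ℝ) × (ℕ → ℝ) → (ℕ → ℝ) × (ℕ → ℝ)) := by
  have hid : noise.map (fun z : ℕ → ℝ => z) = noise := Measure.map_id
  have hprod : (prior α).prod noise = (noise.prod noise).map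
      (Prod.map (fun z k => √(priorVar α k) * z k) fun z => z) := by
    rw [← Measure.map_prod_map _ _ (measurable_mul_seq _) measurable_id', hid, prior_eq]
  rw [dataLaw_eq, compProd_gaussianKernel, hprod, Measure.map_map measurable_swap
    (measurable_fst.prodMk (measurable_affine _ _)), Measure.map_map
    (measurable_swap.comp (measurable_fst.prodMk (measurable_affine _ _)))
    ((measurable_mul_seq _).prodMap measurable_id')]
  congr 1
  ext p k <;> simp

theorem dataLaw_comp_prior (α : ℝ) {n : ℕ} (hn : 1 ≤ n) :
    dataLaw n ∘ₘ prior α = noise.map fun z k => √(priorVar α k + (n : ℝ)⁻¹) * z k := by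
  have h1 : dataLaw n ∘ₘ prior α = ((prior α ⊗ₘ dataLaw n).map Prod.swap).fst := by
    rw [Measure.fst_map_swap, Measure.snd_compProd]
  rw [h1, prior_compProd_dataLaw, joint_law α hn, Measure.fst, Measure.map_map measurable_fst]
  · have h2 := Measure.map_map (μ := noise.prod noise)
      (measurable_mul_seq fun k => √(priorVar α k + (n : ℝ)⁻¹)) measurable_fst
    have h3 : (noise.prod noise).map Prod.fst = noise := by
      rw [← Measure.fst, Measure.fst_prod]
    rw [h3] at h2
    exact h2.symm
  · refine ((measurable_mul_seq _).comp measurable_fst).prodMk ?_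
    have := measurable_affine (fun k => shrink α n k * √(priorVar α k + (n : ℝ)⁻¹)) (postDev α n)
    simpa [mul_assoc] using this

/-- Conjugacy: the posterior is Gaussian. -/
theorem ae_post_eq (α : ℝ) {n : ℕ} (hn : 1 ≤ n) :
    ∀ᵐ y ∂(dataLaw n ∘ₘ prior α), post α n y = gaussianKernel (shrink α n) (postDev α n) y := by
  have h : gaussianKernel (shrink α n) (postDev α n) =ᵐ[dataLaw n ∘ₘ prior α]
      posterior (dataLaw n) (prior α) := by
    refine ae_eq_posterior_of_compProd_eq ?_
    have hid : noise.map (fun z : ℕ → ℝ => z) = noise := Measure.map_id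
    have hprod : (dataLaw n ∘ₘ prior α).prod noise = (noise.prod noise).map
        (Prod.map (fun z k => √(priorVar α k + (n : ℝ)⁻¹) * z k) fun z => z) := by
      rw [← Measure.map_prod_map _ _ (measurable_mul_seq _) measurable_id', hid,
        dataLaw_comp_prior α hn]
    rw [prior_compProd_dataLaw, joint_law α hn, compProd_gaussianKernel, hprod, Measure.map_map
      (measurable_fst.prodMk (measurable_affine _ _))
      ((measurable_mul_seq _).prodMap measurable_id')]
    rfl
  filter_upwards [h] with y hy
  exact hy.symm

theorem dataLaw_absolutelyContinuous {n : ℕ} (hn : 1 ≤ n) {θ η : ℕ → ℝ} (hθ : SqSummable θ)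
    (hη : SqSummable η) : dataLaw n θ ≪ dataLaw n η := by
  have hsh : SqSummable fun k => √(n : ℝ) * (θ k - η k) := by
    have := (hθ.sub hη).mul_left (√(n : ℝ) ^ 2)
    refine this.congr fun k => ?_
    simp only [Pi.sub_apply]; ring
  rw [dataLaw_eq, gaussianKernel_apply, gaussianKernel_apply]
  have hm := measurable_affine_right (fun _ => 1) (fun _ => (√(n : ℝ))⁻¹)
  have hm2 : Measurable fun (z : ℕ → ℝ) k => √(n : ℝ) * (θ k - η k) + z k :=
    measurable_pi_lambda _ fun k => (measurable_const_add _).comp (measurable_pi_apply k)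
  have heq : (noise.map fun (z : ℕ → ℝ) k => 1 * θ k + (√(n : ℝ))⁻¹ * z k) =
      (noise.map fun z k => √(n : ℝ) * (θ k - η k) + z k).map
        fun z k => 1 * η k + (√(n : ℝ))⁻¹ * z k := by
    rw [Measure.map_map (hm η) hm2]
    congr 1
    ext z k
    simp only [Function.comp_apply]
    field_simp
    ring
  rw [heq]
  exact (noise_map_shift_absolutelyContinuous hsh).map (hm η)

theorem dataLaw_absolutelyContinuous_comp {α : ℝ} (hα : 0 < α) {n : ℕ} (hn : 1 ≤ n) {θ : ℕ → ℝ}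
    (hθ : SqSummable θ) : dataLaw n θ ≪ dataLaw n ∘ₘ prior α := by
  refine Measure.AbsolutelyContinuous.mk fun A hA h0 => ?_
  rw [Measure.bind_apply hA (dataLaw n).aemeasurable,
    lintegral_eq_zero_iff ((dataLaw n).measurable_coe hA)] at h0
  have hsq : ∀ᵐ η ∂prior α, SqSummable η := by
    rw [prior_eq, ae_map_iff (measurable_mul_seq _).aemeasurable measurableSet_sqSummable]
    refine ae_sqSummable_mul ((summable_rpow_weights hα).congr fun k => ?_)
    rw [Real.sq_sqrt (priorVar_pos α k).le, priorVar]
  obtain ⟨η, h1, h2⟩ := (h0.and hsq).exists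
  exact dataLaw_absolutelyContinuous hn hθ h2 h1

/-! ### The spread and the bias of the posterior -/

theorem one_add_mul_priorVar_pos (α : ℝ) (n k : ℕ) : 0 < 1 + n * priorVar α k := by
  have := priorVar_pos α k
  positivity

theorem postDev_sq (α : ℝ) (n k : ℕ) :
    postDev α n k ^ 2 = priorVar α k / (1 + n * priorVar α k) :=
  Real.sq_sqrt (div_nonneg (priorVar_pos α k).le (one_add_mul_priorVar_pos α n k).le)

theorem postDev_ne_zero (α : ℝ) (n k : ℕ) : postDev α n k ≠ 0 :=
  (Real.sqrt_pos.2 (div_pos (priorVar_pos α k) (one_add_mul_priorVar_pos α n k))).ne'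

theorem postDev_sq_le (α : ℝ) (n k : ℕ) : postDev α n k ^ 2 ≤ priorVar α k := by
  have := priorVar_pos α k
  rw [postDev_sq]
  exact div_le_self this.le (le_add_of_nonneg_right (by positivity))

theorem sqSummable_postDev {α : ℝ} (hα : 0 < α) (n : ℕ) : SqSummable (postDev α n) :=
  Summable.of_nonneg_of_le (fun _ => sq_nonneg _) (postDev_sq_le α n) (summable_rpow_weights hα)

theorem dominated_postDev (α : ℝ) {n : ℕ} (hn : 1 ≤ n) : Dominated α n (postDev α n) := by
  refine fun k => le_min ?_ (postDev_sq_le α n k)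
  have hn0 : (0 : ℝ) < n := by exact_mod_cast hn
  rw [postDev_sq, div_le_iff₀ (one_add_mul_priorVar_pos α n k), mul_add, mul_one,
    inv_mul_cancel_left₀ hn0.ne']
  exact le_add_of_nonneg_left (by positivity)

theorem priorVar_le_one {α : ℝ} (hα : 0 < α) (k : ℕ) : priorVar α k ≤ 1 :=
  Real.rpow_le_one_of_one_le_of_nonpos (by simp) (by linarith)

theorem dominated_two_postDev_one {α : ℝ} (hα : 0 < α) : Dominated α 2 (postDev α 1) := by
  refine fun k => le_min ?_ (postDev_sq_le α 1 k)
  have h1 := priorVar_le_one hα k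
  rw [postDev_sq, div_le_iff₀ (one_add_mul_priorVar_pos α 1 k)]
  push_cast
  linarith

theorem sqrt_le_postDev (α : ℝ) {n k : ℕ} (hn : 1 ≤ n) (hk : ((k : ℝ) + 1) ^ (2 * α + 1) ≤ n) :
    √(1 / (2 * n)) ≤ postDev α n k := by
  have hx : 0 < ((k : ℝ) + 1) ^ (2 * α + 1) := by positivity
  have h1 : 1 ≤ n * priorVar α k := by
    rw [priorVar, Real.rpow_neg (by positivity), ← div_eq_mul_inv]
    exact (one_le_div hx).2 hk
  refine Real.sqrt_le_sqrt ?_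
  rw [div_le_div_iff₀ (by positivity) (one_add_mul_priorVar_pos α n k)]
  linarith

theorem shrink_le_one (α : ℝ) (n k : ℕ) : shrink α n k ≤ 1 :=
  (div_le_one (one_add_mul_priorVar_pos α n k)).2 (by linarith)

theorem shrink_nonneg (α : ℝ) (n k : ℕ) : 0 ≤ shrink α n k := by
  have := priorVar_pos α k
  unfold shrink
  positivity

theorem dominated_shrink_mul (α : ℝ) {n : ℕ} (hn : 1 ≤ n) :
    Dominated α n fun k => shrink α n k * (√(n : ℝ))⁻¹ := by
  have hn0 : (0 : ℝ) < n := by exact_mod_cast hn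
  intro k
  have h1 : (shrink α n k * (√(n : ℝ))⁻¹) ^ 2 = postDev α n k ^ 2 * shrink α n k := by
    rw [mul_pow, inv_pow, Real.sq_sqrt hn0.le, postDev_sq, shrink]
    have := (one_add_mul_priorVar_pos α n k).ne'
    field_simp
  rw [h1]
  exact (mul_le_of_le_one_right (sq_nonneg _) (shrink_le_one α n k)).trans
    (dominated_postDev α hn k)

theorem one_sub_shrink_le {α : ℝ} (hα : 0 < α) {n : ℕ} (hn : 1 ≤ n) (k : ℕ) :
    1 - shrink α n k ≤ (n : ℝ) ^ (-α / (2 * α + 1)) * ((k : ℝ) + 1) ^ α := by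
  have hn0 : (0 : ℝ) < n := by exact_mod_cast hn
  have hd : 0 < 2 * α + 1 := by linarith
  set x : ℝ := (k : ℝ) + 1
  have hx0 : 0 < x := by positivity
  set u : ℝ := (n : ℝ) ^ (1 / (2 * α + 1)) with hu
  have hu0 : 0 < u := by positivity
  have hq : (n : ℝ) ^ (-α / (2 * α + 1)) * x ^ α = (x / u) ^ α := by
    rw [Real.div_rpow hx0.le hu0.le, hu, ← Real.rpow_mul hn0.le, div_eq_mul_inv (x ^ α),
      ← Real.rpow_neg hn0.le, mul_comm]
    congr 2
    ring
  have hnu : (n : ℝ) * priorVar α k = (u / x) ^ (2 * α + 1) := by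
    rw [Real.div_rpow hu0.le hx0.le, hu, ← Real.rpow_mul hn0.le, one_div_mul_cancel hd.ne',
      Real.rpow_one, priorVar, Real.rpow_neg hx0.le, div_eq_mul_inv]
  have h1 : 1 - shrink α n k = (1 + n * priorVar α k)⁻¹ := by
    have := (one_add_mul_priorVar_pos α n k).ne'
    rw [shrink]
    field_simp
    ring
  rw [hq]
  rcases le_total u x with h | h
  · refine le_trans ?_ (Real.one_le_rpow ((one_le_div hu0).2 h) hα.le)
    linarith [shrink_nonneg α n k]
  · rw [h1, hnu, ← inv_div u x, Real.inv_rpow (by positivity)]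
    refine inv_anti₀ (by positivity) ?_
    have := Real.rpow_le_rpow_of_exponent_le ((one_le_div hx0).2 h)
      (show α ≤ 2 * α + 1 by linarith)
    linarith

theorem summable_abs_of_mem_holderBall {α R : ℝ} (hα : 0 < α) {θ : ℕ → ℝ}
    (h : θ ∈ holderBall α R) : Summable fun k => |θ k| :=
  Summable.of_nonneg_of_le (fun _ => abs_nonneg _) (fun k => le_mul_of_one_le_left (abs_nonneg _)
    (Real.one_le_rpow (by simp) hα.le)) h.1

theorem sqSummable_of_mem_holderBall {α R : ℝ} (hα : 0 < α) {θ : ℕ → ℝ}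
    (h : θ ∈ holderBall α R) : SqSummable θ := by
  have hs := summable_abs_of_mem_holderBall hα h
  refine Summable.of_nonneg_of_le (fun _ => sq_nonneg _) (fun k => ?_)
    (hs.mul_left (∑' k, |θ k|))
  rw [← sq_abs, sq]
  exact mul_le_mul_of_nonneg_right (hs.le_tsum k fun _ _ => abs_nonneg _) (abs_nonneg _)

theorem zero_mem_holderBall (α : ℝ) {R : ℝ} (hR : 0 < R) : (0 : ℕ → ℝ) ∈ holderBall α R := by
  simp [holderBall, hR.le, summable_zero]

theorem supN_bias_le {α R : ℝ} (hα : 0 < α) {n : ℕ} (hn : 1 ≤ n) {θ : ℕ → ℝ}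
    (h : θ ∈ holderBall α R) (hR : √2 * R ≤ √(Real.log n)) :
    supN (fun k => (1 - shrink α n k) * θ k) ≤ ENNReal.ofReal (rate α n) := by
  set ρ : ℝ := (n : ℝ) ^ (-α / (2 * α + 1))
  have hρ0 : 0 ≤ ρ := by positivity
  have hle : ∀ k, |(1 - shrink α n k) * θ k| ≤ ρ * (((k : ℝ) + 1) ^ α * |θ k|) := fun k => by
    rw [abs_mul, abs_of_nonneg (by linarith [shrink_le_one α n k]), ← mul_assoc]
    exact mul_le_mul_of_nonneg_right (one_sub_shrink_le hα hn k) (abs_nonneg _)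
  have hs := Summable.of_nonneg_of_le (fun _ => abs_nonneg _) hle (h.1.mul_left ρ)
  refine (supN_le_of_summable_abs hs).trans (ENNReal.ofReal_le_ofReal ?_)
  have h1 := hs.tsum_le_tsum hle (h.1.mul_left ρ)
  rw [tsum_mul_left] at h1
  calc _ ≤ √2 * (ρ * R) :=
        mul_le_mul_of_nonneg_left (h1.trans (mul_le_mul_of_nonneg_left h.2 hρ0)) (by positivity)
    _ = ρ * (√2 * R) := by ring
    _ ≤ rate α n := mul_le_mul_of_nonneg_left hR hρ0

theorem rate_nonneg (α : ℝ) (n : ℕ) : 0 ≤ rate α n := by unfold rate; positivity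

/-! ### The distance of the posterior to its mean and of the mean to the truth -/

theorem supDist_comm (f g : Lp ℝ 2 unitMeasure) : supDist f g = supDist g f := by
  rw [supDist, supDist, ← neg_sub g f, eLpNorm_congr_ae (Lp.coeFn_neg _), eLpNorm_neg]

theorem supDist_triangle (f g h : Lp ℝ 2 unitMeasure) :
    supDist f h ≤ supDist f g + supDist g h := by
  rw [supDist, ← sub_add_sub_cancel f g h, eLpNorm_congr_ae (Lp.coeFn_add _ _)]
  exact eLpNorm_add_le (Lp.aestronglyMeasurable _) (Lp.aestronglyMeasurable _) le_top

theorem integral_gaussianKernel (c s y : ℕ → ℝ) (k : ℕ) :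
    ∫ θ, θ k ∂(gaussianKernel c s y) = c k * y k := by
  have hi : Integrable (fun z : ℕ → ℝ => z k) noise := by
    have h : Integrable id (noise.map fun z : ℕ → ℝ => z k) := by
      rw [noise_map_eval]
      exact (memLp_id_gaussianReal 1).integrable le_rfl
    exact h.comp_measurable (measurable_pi_apply k)
  have h0 : ∫ z, z k ∂noise = 0 := by
    have h := integral_map (μ := noise) (measurable_pi_apply k).aemeasurable
      (f := fun x : ℝ => x) (by fun_prop)
    rw [← h, noise_map_eval]
    exact integral_id_gaussianReal
  rw [gaussianKernel_apply, integral_map (measurable_affine_right c s y).aemeasurable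
    (measurable_pi_apply k).aestronglyMeasurable, integral_add (integrable_const _)
    (hi.const_mul _), integral_const_mul _ fun z : ℕ → ℝ => z k, h0]
  simp

theorem gaussianKernel_ball {c s y : ℕ → ℝ} (hy : SqSummable fun k => c k * y k)
    (hs : SqSummable s) (a : ℝ≥0∞) :
    gaussianKernel c s y {θ | supDist (fourierSum θ) (fourierSum fun k => c k * y k) ≤ a} =
      noise {z | supN (fun k => s k * z k) ≤ a} := by
  rw [gaussianKernel_apply, Measure.map_apply (measurable_affine_right c s y)
    (measurableSet_setOf_supDist_le _ a)]
  refine measure_congr ?_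
  filter_upwards [ae_sqSummable_mul hs] with z hz
  refine propext ?_
  change supDist (fourierSum fun k => c k * y k + s k * z k) _ ≤ a ↔ supN _ ≤ a
  have h : supDist (fourierSum fun k => c k * y k + s k * z k) (fourierSum fun k => c k * y k) =
      supN fun k => s k * z k := by
    refine (supDist_eq (hy.add hz) hy).trans (congrArg supN ?_)
    ext k
    simp
  rw [h]

theorem ae_posterior {α : ℝ} (hα : 0 < α) {n : ℕ} (hn : 1 ≤ n) {θ : ℕ → ℝ} (hθ : SqSummable θ) :
    ∀ᵐ y ∂(dataLaw n θ), (SqSummable fun k => shrink α n k * y k) ∧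
      post α n y = gaussianKernel (shrink α n) (postDev α n) y ∧
      postMean α n y = fourierSum fun k => shrink α n k * y k := by
  have h1 := (dataLaw_absolutelyContinuous_comp hα hn hθ).ae_le (ae_post_eq α hn)
  have h2 : ∀ᵐ y ∂(dataLaw n θ), SqSummable fun k => shrink α n k * y k := by
    have hm : MeasurableSet {y : ℕ → ℝ | SqSummable fun k => shrink α n k * y k} :=
      measurable_mul_seq (shrink α n) measurableSet_sqSummable
    rw [dataLaw_eq, gaussianKernel_apply,
      ae_map_iff (measurable_affine_right (fun _ => 1) _ θ).aemeasurable hm]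
    filter_upwards [ae_sqSummable_mul ((dominated_shrink_mul α hn).sqSummable hα)] with z hz
    have hc : SqSummable fun k => shrink α n k * θ k := hθ.mono fun k => by
      rw [abs_mul, abs_of_nonneg (shrink_nonneg α n k)]
      exact mul_le_of_le_one_left (abs_nonneg _) (shrink_le_one α n k)
    refine (hc.add hz).congr fun k => ?_
    simp only [Pi.add_apply]
    ring
  filter_upwards [h1, h2] with y hy1 hy2
  refine ⟨hy2, hy1, ?_⟩
  rw [postMean, hy1]
  simp_rw [integral_gaussianKernel]

/-- The credible balls around the posterior mean have deterministic credibility. -/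
theorem ae_post_ball {α : ℝ} (hα : 0 < α) {n : ℕ} (hn : 1 ≤ n) {θ : ℕ → ℝ} (hθ : SqSummable θ) :
    ∀ᵐ y ∂(dataLaw n θ), ∀ a : ℝ≥0∞,
      post α n y {η | supDist (fourierSum η) (postMean α n y) ≤ a} =
        noise {z | supN (fun k => postDev α n k * z k) ≤ a} := by
  filter_upwards [ae_posterior hα hn hθ] with y ⟨h1, h2, h3⟩ a
  rw [h2, h3, gaussianKernel_ball h1 (sqSummable_postDev hα n)]

theorem dataLaw_postMean_gt_le {α R : ℝ} (hα : 0 < α) {n : ℕ} (hn : 2 ≤ n) {θ : ℕ → ℝ}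
    (h : θ ∈ holderBall α R) (hR : √2 * R ≤ √(Real.log n)) :
    dataLaw n θ {y | ENNReal.ofReal ((tailConst α + 1) * rate α n) <
      supDist (fourierSum θ) (postMean α n y)} ≤ ENNReal.ofReal (12 * (n : ℝ) ^ (-1 : ℝ)) := by
  have hn1 : 1 ≤ n := by omega
  have hθ := sqSummable_of_mem_holderBall hα h
  have hτ := dominated_shrink_mul α hn1
  set D : Set (ℕ → ℝ) := {y | ENNReal.ofReal ((tailConst α + 1) * rate α n) <
    supN fun k => θ k + -shrink α n k * y k} with hD
  have hDm : MeasurableSet D := by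
    have hm : Measurable fun y : ℕ → ℝ => supN fun k => θ k + -shrink α n k * y k := by
      have := measurable_affine_right (fun _ => 1) (fun k => -shrink α n k) θ
      simp only [one_mul] at this
      exact measurable_supN.comp this
    exact measurableSet_lt measurable_const hm
  calc _ ≤ dataLaw n θ D := by
        refine measure_mono_ae ?_
        filter_upwards [ae_posterior hα hn1 hθ] with y ⟨h1, h2, h3⟩ hy
        change _ < supDist _ _ at hy
        rw [h3, supDist_eq hθ h1] at hy
        rw [hD]
        change _ < supN _
        convert hy using 2
        ext k
        simp [sub_eq_add_neg]
    _ ≤ noise {z | ENNReal.ofReal (tailConst α * √1 * rate α n) <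
          supN fun k => shrink α n k * (√(n : ℝ))⁻¹ * z k} := by
        rw [dataLaw_eq, gaussianKernel_apply, Measure.map_apply (measurable_affine_right _ _ _) hDm]
        refine measure_mono_ae ?_
        filter_upwards [ae_sqSummable_mul (hτ.sqSummable hα)] with z hz hzD
        change _ < supN _ at hzD
        change _ < supN _
        have hb : SqSummable fun k => (1 - shrink α n k) * θ k := hθ.mono fun k => by
          rw [abs_mul, abs_of_nonneg (by linarith [shrink_le_one α n k])]
          exact mul_le_of_le_one_left (abs_nonneg _) (by linarith [shrink_nonneg α n k])
        have heq : (fun k => θ k + -shrink α n k * (1 * θ k + (√(n : ℝ))⁻¹ * z k)) =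
            (fun k => (1 - shrink α n k) * θ k) - fun k => shrink α n k * (√(n : ℝ))⁻¹ * z k := by
          ext k
          simp only [Pi.sub_apply]
          ring
        rw [heq] at hzD
        have hlt := hzD.trans_le ((supN_sub_le hb hz).trans
          (add_le_add_left (supN_bias_le hα hn1 h hR) _))
        rw [Real.sqrt_one, mul_one]
        rw [add_mul, one_mul, add_comm (ENNReal.ofReal _), ENNReal.ofReal_add
          (mul_nonneg (tailConst_nonneg α) (rate_nonneg α n)) (rate_nonneg α n)] at hlt
        exact lt_of_add_lt_add_right hlt
    _ ≤ _ := noise_supN_gt_le hα hn hτ le_rfl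

theorem lintegral_post_gt_le {α R : ℝ} (hα : 0 < α) {n : ℕ} (hn : 2 ≤ n) {θ : ℕ → ℝ}
    (h : θ ∈ holderBall α R) (hR : √2 * R ≤ √(Real.log n)) {K : ℝ}
    (hK : 2 * tailConst α + 1 ≤ K) :
    ∫⁻ y, post α n y {η | ENNReal.ofReal (K * rate α n) < supDist (fourierSum η) (fourierSum θ)}
      ∂(dataLaw n θ) ≤ 2 * ENNReal.ofReal (12 * (n : ℝ) ^ (-1 : ℝ)) := by
  have hn1 : 1 ≤ n := by omega
  have hθ := sqSummable_of_mem_holderBall hα h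
  set p := ENNReal.ofReal (12 * (n : ℝ) ^ (-1 : ℝ))
  set a := ENNReal.ofReal (tailConst α * rate α n) with ha
  set b := ENNReal.ofReal ((tailConst α + 1) * rate α n) with hb
  have hr := rate_nonneg α n
  have hT := tailConst_nonneg α
  have hab : a + b ≤ ENNReal.ofReal (K * rate α n) := by
    rw [ha, hb, ← ENNReal.ofReal_add (by positivity) (by positivity)]
    refine ENNReal.ofReal_le_ofReal ?_
    rw [← add_mul]
    exact mul_le_mul_of_nonneg_right (by linarith) hr
  set D : Set (ℕ → ℝ) := {y | b < supDist (fourierSum θ) (postMean α n y)}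
  have hnoise : noise {z | a < supN fun k => postDev α n k * z k} ≤ p := by
    have := noise_supN_gt_le hα hn (dominated_postDev α hn1) le_rfl
    rwa [Real.sqrt_one, mul_one] at this
  have hae : ∀ᵐ y ∂(dataLaw n θ), post α n y {η | ENNReal.ofReal (K * rate α n) <
      supDist (fourierSum η) (fourierSum θ)} ≤ p + D.indicator 1 y := by
    filter_upwards [ae_post_ball hα hn1 hθ] with y hy
    have : IsProbabilityMeasure (post α n y) := by unfold post; infer_instance
    by_cases hyD : y ∈ D
    · rw [Set.indicator_of_mem hyD]
      exact prob_le_one.trans le_add_self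
    · rw [Set.indicator_of_notMem hyD, add_zero]
      refine le_trans ?_ hnoise
      have h1 : {z : ℕ → ℝ | a < supN fun k => postDev α n k * z k} =
          {z | supN (fun k => postDev α n k * z k) ≤ a}ᶜ := by
        ext z; simp
      have h2 : {η | supDist (fourierSum η) (postMean α n y) ≤ a}ᶜ =
          {η | a < supDist (fourierSum η) (postMean α n y)} := by
        ext η; simp
      have hm : MeasurableSet {z : ℕ → ℝ | supN (fun k => postDev α n k * z k) ≤ a} :=
        measurable_supN_mul _ measurableSet_Iic
      rw [h1, prob_compl_eq_one_sub hm, ← hy a,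
        ← prob_compl_eq_one_sub (measurableSet_setOf_supDist_le _ a), h2]
      refine measure_mono fun η hη => ?_
      rw [Set.mem_ofPred_eq] at hη ⊢
      by_contra! hle
      have hyb : supDist (fourierSum θ) (postMean α n y) ≤ b := not_lt.1 hyD
      refine absurd (hab.trans_lt hη) (not_lt.2 ?_)
      exact (supDist_triangle _ (postMean α n y) _).trans
        (add_le_add hle (by rwa [supDist_comm]))
  calc _ ≤ ∫⁻ y, p + D.indicator 1 y ∂(dataLaw n θ) := lintegral_mono_ae hae
    _ = p + ∫⁻ y, D.indicator 1 y ∂(dataLaw n θ) := by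
        rw [lintegral_add_left measurable_const, lintegral_const, measure_univ, mul_one]
    _ ≤ p + p := by
        gcongr
        exact (lintegral_indicator_one_le D).trans (dataLaw_postMean_gt_le hα hn h hR)
    _ = 2 * p := (two_mul p).symm

/-! ### The radius of the credible ball -/

theorem exists_credible_radius {α : ℝ} (hα : 0 < α) {n : ℕ} (hn : 1 ≤ n) {c : ℝ} (hc0 : 0 < c)
    (hc1 : c < 1) : ∃ q : ℝ, 0 < q ∧ ∀ r : ℝ,
      noise {z | supN (fun k => postDev α n k * z k) ≤ ENNReal.ofReal r} = ENNReal.ofReal c ↔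
        r = q := by
  rcases hn.eq_or_lt with rfl | h
  · exact exists_quantile hα le_rfl (dominated_two_postDev_one hα) (postDev_ne_zero α 1 0) hc0 hc1
  · exact exists_quantile hα h (dominated_postDev α hn) (postDev_ne_zero α n 0) hc0 hc1

theorem exists_radius_le {α : ℝ} (hα : 0 < α) {γ : ℝ} (hγ0 : 0 < γ) (hγ1 : γ < 1) :
    ∃ C : ℝ, 0 < C ∧ ∀ n : ℕ, 2 ≤ n → ∀ q : ℝ,
      noise {z | supN (fun k => postDev α n k * z k) ≤ ENNReal.ofReal q} = ENNReal.ofReal (1 - γ) →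
        q ≤ C * rate α n := by
  obtain ⟨A, hA⟩ := exists_pow_lt_of_lt_one (show 0 < γ / 12 by positivity)
    (show (1 / 2 : ℝ) < 1 by norm_num)
  set B : ℝ := (A : ℝ) + 1 with hB
  have hB1 : 1 ≤ B := by simp [hB]
  have hT := tailConst_nonneg α
  refine ⟨tailConst α * √B + 1, by positivity, fun n hn q hq => ?_⟩
  have hn2 : (2 : ℝ) ≤ n := by exact_mod_cast hn
  have hr := rate_nonneg α n
  by_contra! hlt
  have hp : (n : ℝ) ^ (-B) < γ / 12 := by
    refine lt_of_le_of_lt ?_ hA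
    rw [Real.rpow_neg (by positivity), one_div, inv_pow]
    refine inv_anti₀ (by positivity) ?_
    rw [← Real.rpow_natCast]
    exact (Real.rpow_le_rpow_of_exponent_le one_le_two (by simp [hB])).trans
      (Real.rpow_le_rpow zero_le_two hn2 (by linarith))
  have hgt := noise_supN_gt_le hα hn (dominated_postDev α (by omega : 1 ≤ n)) hB1
  have hle : tailConst α * √B * rate α n ≤ q := by linarith
  have h1 : (1 : ℝ≥0∞) ≤ ENNReal.ofReal (1 - γ) + ENNReal.ofReal (12 * (n : ℝ) ^ (-B)) := by
    calc (1 : ℝ≥0∞) = noise Set.univ := measure_univ.symm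
      _ ≤ noise ({z | supN (fun k => postDev α n k * z k) ≤ ENNReal.ofReal q} ∪
          {z | ENNReal.ofReal (tailConst α * √B * rate α n) <
            supN fun k => postDev α n k * z k}) := by
          refine measure_mono fun z _ => ?_
          rw [Set.mem_union, Set.mem_ofPred_eq, Set.mem_ofPred_eq]
          refine (le_or_gt _ _).imp_right fun h => ?_
          exact (ENNReal.ofReal_le_ofReal hle).trans_lt h
      _ ≤ _ := (measure_union_le _ _).trans (add_le_add hq.le hgt)
  rw [← ENNReal.ofReal_add (by linarith) (by positivity), ENNReal.one_le_ofReal] at h1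
  linarith

theorem lowerConst_pos {α : ℝ} (hα : 0 < α) : 0 < lowerConst α :=
  Real.sqrt_pos.2 (by positivity)

theorem eventually_le_radius {α : ℝ} (hα : 0 < α) {c : ℝ} (hc : 0 < c) :
    ∀ᶠ n : ℕ in atTop, ∀ q : ℝ,
      noise {z | supN (fun k => postDev α n k * z k) ≤ ENNReal.ofReal q} = ENNReal.ofReal c →
        lowerConst α * rate α n ≤ q := by
  have h := tendsto_noise_supN_le hα (sqSummable_postDev hα) fun n k hn hk => sqrt_le_postDev α hn hk
  filter_upwards [h.eventually_lt_const (ENNReal.ofReal_pos.2 hc)] with n hn q hq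
  by_contra! hlt
  refine absurd (hq ▸ hn) (not_lt.2 (measure_mono fun z hz => ?_))
  exact le_trans hz (ENNReal.ofReal_le_ofReal hlt.le)

theorem eventually_le_sqrt_log (a : ℝ) : ∀ᶠ n : ℕ in atTop, a ≤ √(Real.log n) :=
  ((Real.tendsto_sqrt_atTop.comp Real.tendsto_log_atTop).comp
    tendsto_natCast_atTop_atTop).eventually_ge_atTop a

theorem tendsto_ofReal_mul_inv (b : ℝ) :
    Tendsto (fun n : ℕ => ENNReal.ofReal (b * (n : ℝ) ^ (-1 : ℝ))) atTop (𝓝 0) := by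
  have h := ((tendsto_rpow_neg_atTop one_pos).comp tendsto_natCast_atTop_atTop).const_mul b
  rw [mul_zero] at h
  simpa using ENNReal.tendsto_ofReal h

end WhiteNoise

end

open WhiteNoise in
theorem theorem1 (α : ℝ) (hα : 0 < α) :
    -- uniform contraction of the posterior in the sup-norm
    (∀ R : ℝ, 0 < R → ∀ M : ℕ → ℝ, Tendsto M atTop atTop →
      Tendsto (fun n : ℕ => ⨆ θ₀ ∈ holderBall α R,
        ∫⁻ y, post α n y {θ | ENNReal.ofReal (M n * rate α n) < supDist (fourierSum θ) (fourierSum θ₀)}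
          ∂(dataLaw n θ₀)) atTop (𝓝 0)) ∧
    ∀ γ : ℝ, 0 < γ → γ < 1 → ∃ h : ℕ → ℝ,
      -- `h n` is deterministic and is the only radius of credibility `1 - γ`
      (∀ n : ℕ, 1 ≤ n → 0 < h n ∧ ∀ R : ℝ, ∀ θ₀ ∈ holderBall α R, ∀ᵐ y ∂(dataLaw n θ₀), ∀ r : ℝ,
        post α n y {θ | supDist (fourierSum θ) (postMean α n y) ≤ ENNReal.ofReal r}
          = ENNReal.ofReal (1 - γ) ↔ r = h n) ∧
      -- the order of the radius
      (∃ C : ℝ, 0 < C ∧ ∀ n : ℕ, 2 ≤ n → h n ≤ C * rate α n) ∧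
      -- uniform coverage of the inflated ball
      ∃ M₀ : ℝ, 0 < M₀ ∧ ∀ M : ℝ, M₀ ≤ M → ∀ R : ℝ, 0 < R →
        Tendsto (fun n : ℕ => ⨅ θ₀ ∈ holderBall α R,
          dataLaw n θ₀ {y | supDist (fourierSum θ₀) (postMean α n y) ≤ ENNReal.ofReal (M * h n)})
          atTop (𝓝 1) := by
  have hT := tailConst_nonneg α
  have hL := lowerConst_pos hα
  refine ⟨fun R _ M hM => ?_, fun γ hγ0 hγ1 => ?_⟩
  · have hlim := ENNReal.Tendsto.const_mul (tendsto_ofReal_mul_inv 12)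
      (Or.inr (ENNReal.ofNat_ne_top (n := 2)))
    rw [mul_zero] at hlim
    refine tendsto_of_tendsto_of_tendsto_of_le_of_le' tendsto_const_nhds hlim
      (Eventually.of_forall fun n => zero_le) ?_
    filter_upwards [eventually_ge_atTop 2, eventually_le_sqrt_log (√2 * R),
      hM.eventually_ge_atTop (2 * tailConst α + 1)] with n hn hlog hMn
    exact iSup₂_le fun θ hθ => lintegral_post_gt_le hα hn hθ hlog hMn
  · have hex : ∀ n : ℕ, ∃ q : ℝ, 1 ≤ n → 0 < q ∧ ∀ r : ℝ,
        noise {z | supN (fun k => postDev α n k * z k) ≤ ENNReal.ofReal r} =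
          ENNReal.ofReal (1 - γ) ↔ r = q := fun n => by
      by_cases hn : 1 ≤ n
      · obtain ⟨q, hq⟩ := exists_credible_radius hα hn (sub_pos.2 hγ1) (sub_lt_self 1 hγ0)
        exact ⟨q, fun _ => hq⟩
      · exact ⟨0, fun h => absurd h hn⟩
    choose h hh using hex
    have hval : ∀ n : ℕ, 1 ≤ n → noise {z | supN (fun k => postDev α n k * z k) ≤
        ENNReal.ofReal (h n)} = ENNReal.ofReal (1 - γ) := fun n hn => ((hh n hn).2 _).2 rfl
    refine ⟨h, fun n hn => ⟨(hh n hn).1, fun R θ hθ => ?_⟩, ?_, ?_⟩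
    · filter_upwards [ae_post_ball hα hn (sqSummable_of_mem_holderBall hα hθ)] with y hy r
      rw [hy]
      exact (hh n hn).2 r
    · obtain ⟨C, hC0, hC⟩ := exists_radius_le hα hγ0 hγ1
      exact ⟨C, hC0, fun n hn => hC n hn _ (hval n (by omega))⟩
    · refine ⟨(tailConst α + 1) / lowerConst α, by positivity, fun M hM R hR => ?_⟩
      have hlim := ENNReal.Tendsto.sub tendsto_const_nhds (tendsto_ofReal_mul_inv 12)
        (Or.inl (ENNReal.one_ne_top))
      rw [tsub_zero] at hlim
      refine tendsto_of_tendsto_of_tendsto_of_le_of_le' hlim tendsto_const_nhds ?_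
        (Eventually.of_forall fun n => (iInf₂_le 0 (zero_mem_holderBall α hR)).trans prob_le_one)
      filter_upwards [eventually_ge_atTop 2, eventually_le_sqrt_log (√2 * R),
        eventually_le_radius hα (sub_pos.2 hγ1)] with n hn hlog hrad
      have hle : (tailConst α + 1) * rate α n ≤ M * h n := by
        have hr := rate_nonneg α n
        have hln := hrad _ (hval n (by omega))
        calc (tailConst α + 1) * rate α n
            = (tailConst α + 1) / lowerConst α * (lowerConst α * rate α n) := by field_simp
          _ ≤ M * h n := mul_le_mul hM hln (by positivity) (le_trans (by positivity) hM)
      refine le_iInf₂ fun θ hθ => tsub_le_iff_right.2 ?_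
      calc (1 : ℝ≥0∞) = dataLaw n θ Set.univ := measure_univ.symm
        _ ≤ dataLaw n θ ({y | supDist (fourierSum θ) (postMean α n y) ≤ ENNReal.ofReal (M * h n)} ∪
            {y | ENNReal.ofReal ((tailConst α + 1) * rate α n) <
              supDist (fourierSum θ) (postMean α n y)}) := by
            refine measure_mono fun y _ => ?_
            rw [Set.mem_union, Set.mem_ofPred_eq, Set.mem_ofPred_eq]
            exact (le_or_gt _ _).imp_right (ENNReal.ofReal_le_ofReal hle).trans_lt
        _ ≤ _ := (measure_union_le _ _).trans
            (add_le_add le_rfl (dataLaw_postMean_gt_le hα hn hθ hlog))
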